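/- Let $l>0$, $\Omega=(-l,l)^2$, $L=2l$, $\beta\in(0,2)$, $\lambda\ge 0$, with $\beta\ne 1$ if $\lambda>0$, and $\gamma\in(\beta,2]$. For $u:\mathbb R^2\to\mathbb R$ put $$-(\Delta+\lambda)^{\beta/2}u(\mathbf x)=c\ \mathrm{P.V.}\!\int_{\mathbb R^2}\frac{u(\mathbf x)-u(\mathbf y)}{e^{\lambda|\mathbf x-\mathbf y|}|\mathbf x-\mathbf y|^{2+\beta}}\,d\mathbf y,$$ where $c=\frac{1}{2\pi|\Gamma(-\beta)|}$ if $\lambda>0$ and $c=\frac{\beta\,\Gamma(1+\beta/2)}{2^{1-\beta}\pi\,\Gamma(1-\beta/2)}$ if $\lambda=0$. Let $u$ solve the tempered fractional Poisson problem $$-(\Delta+\lambda)^{\beta/2}u=f\ \text{ in }\Omega,\qquad u=0\ \text{ in }\mathbb R^2\setminus\Omega .$$ *The scheme.* For an integer $N\ge1$ let $h=L/N$, $\xi_i=\eta_i=ih$, $K_{i,j}=[\xi_i,\xi_{i+1}]\times[\eta_j,\eta_{j+1}]$, $\omega(\xi,\eta)=(\xi^2+\eta^2)^{(\gamma-2-\beta)/2}$,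 and let $k_\gamma=1$ if $\gamma<2$, $k_2=\frac43$. Put $G_{0,0}=\iint_{K_{0,0}}\omega$ and $m_{i,j}(a,b)=h^{-2}\iint_{K_{i,j}}(\xi-a)(\eta-b)\,\omega\,d\xi d\eta$ for $(i,j)\ne(0,0)$. Let $a_{i,j}$, for $0\le i,j\le N$, $(i,j)\neq(0,0)$, be the coefficient of $\phi(\xi_i,\eta_j)$ in the quadrature rule for $\int_0^L\!\int_0^L\phi\,\omega$ which uses on $K_{0,0}$ the weighted trapezoidal value $\frac{k_\gamma}{4}\big(\phi(0,h)+\phi(h,h)+\phi(h,0)\big)G_{0,0}$, and on each other cell $K_{i,j}$, $0\le i,j\le N-1$, the integral of $\omega$ times the bilinear interpolant of $\phi$, namely $$\phi(\xi_i,\eta_j)\,m_{i,j}(\xi_{i+1},\eta_{j+1})-\phi(\xi_{i+1},\eta_j)\,m_{i,j}(\xi_i,\eta_{j+1})-\phi(\xi_i,\eta_{j+1})\,m_{i,j}(\xi_{i+1},\eta_j)+\phi(\xi_{i+1},\eta_{j+1})\,m_{i,j}(\xi_i,\eta_j).$$ With $r_{i,j}=\sqrt{\xi_i^2+\eta_j^2}$,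 $\tilde a_{i,j}=a_{i,j}\,e^{-\lambda r_{i,j}}r_{i,j}^{-\gamma}$ and $G^\infty=\iint_{[0,\infty)^2\setminus[0,L]^2}e^{-\lambda r}r^{-2-\beta}\,d\xi d\eta$, where $r=\sqrt{\xi^2+\eta^2}$, set $$w_{0,0}=4c\Big(\sum_{(i,j)\ne(0,0)}\tilde a_{i,j}+G^\infty\Big),\qquad w_{i,j}=-2c\,\tilde a_{i,j}\ \text{ if exactly one of } i,j \text{ is } 0,\qquad w_{i,j}=-c\,\tilde a_{i,j}\ \text{ if } i,j\ge1 .$$ Let $B$ be the matrix indexed by the pairs $(p,q)$, $1\le p,q\le N-1$, with entries $B_{(p,q),(p',q')}=w_{|p-p'|,|q-q'|}$, and let $\mathbf U=(u(-l+ph,-l+qh))_{p,q}$, $F=(f(-l+ph,-l+qh))_{p,q}$. *Claim.* There is a constant $C>0$ depending only on $\beta,\lambda,\gamma,l$ such that, whenever $u\in C^2(\mathbb R^2)$ is a solution of the problem above and $N\ge1$, the system $B\mathbf U_h=F$ has exactly one solution $\mathbf U_h$, and $$\|\mathbf U-\mathbf U_h\|\le C\,|u|_2\,h^{2-\beta},\qquad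 \|\mathbf U-\mathbf U_h\|_\infty\le C\,|u|_2\,h^{2-\beta},$$ where $|u|_2=\sup_{\mathbb R^2}\|D^2u\|<\infty$, $\|\mathbf V\|=\big(h^2\sum_{p,q}V_{p,q}^2\big)^{1/2}$ is the discrete $L_2$ norm and $\|\mathbf V\|_\infty=\max_{p,q}|V_{p,q}|$. -/

import Mathlib

open Real Set Filter Topology MeasureTheory

namespace TemperedFD

noncomputable section

/-- Euclidean length of a vector of the plane (the norm that Mathlib puts on `ℝ × ℝ` is the sup
norm). -/
def eucl (z : ℝ × ℝ) : ℝ := √(z.1 ^ 2 + z.2 ^ 2)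

/-- The normalization constant of the tempered fractional Laplacian in dimension `n`:
`Γ(n/2) / (2 π^{n/2} |Γ(-β)|)` in the tempered case, and the usual constant
`β Γ((n+β)/2) / (2^{1-β} π^{n/2} Γ(1-β/2))` of the fractional Laplacian when `lam = 0`. -/
def normConst (n : ℕ) (β lam : ℝ) : ℝ :=
  if lam = 0 then
    β * Real.Gamma ((n + β) / 2) / (2 ^ (1 - β) * π ^ ((n : ℝ) / 2) * Real.Gamma (1 - β / 2))
  else
    Real.Gamma ((n : ℝ) / 2) / (2 * π ^ ((n : ℝ) / 2) * |Real.Gamma (-β)|)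

/-- `v` is the value at `x` of `-(Δ + lam)^{β/2} u`, that is, of
`c P.V. ∫ (u x - u y) / (e^{lam |x - y|} |x - y|^{2 + β}) dy`, the principal value being the limit
of the (absolutely convergent) integrals over `|x - y| > ε` as `ε → 0+`. -/
def IsNegTemperedLaplacianAt (β lam : ℝ) (u : ℝ × ℝ → ℝ) (x : ℝ × ℝ) (v : ℝ) : Prop :=
  (∀ ε > 0, IntegrableOn
    (fun y => (u x - u y) / (exp (lam * eucl (x - y)) * eucl (x - y) ^ (2 + β)))
    {y | ε < eucl (x - y)}) ∧
  Tendsto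
    (fun ε : ℝ => normConst 2 β lam *
      ∫ y in {y | ε < eucl (x - y)},
        (u x - u y) / (exp (lam * eucl (x - y)) * eucl (x - y) ^ (2 + β)))
    (𝓝[>] 0) (𝓝 v)

/-- The square `(-l, l) × (-l, l)`. -/
def square (l : ℝ) : Set (ℝ × ℝ) := Ioo (-l) l ×ˢ Ioo (-l) l

/-- `u` solves `-(Δ + lam)^{β/2} u = f` in the square `(-l, l)²` and `u = 0` outside of it. -/
def IsExactSolution (β lam l : ℝ) (f u : ℝ × ℝ → ℝ) : Prop :=
  (∀ x ∈ square l, IsNegTemperedLaplacianAt β lam u x (f x)) ∧ ∀ x ∉ square l, u x = 0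

/-- The mesh size `h = L / N` with `L = 2 l`. -/
def mesh (l : ℝ) (N : ℕ) : ℝ := 2 * l / N

/-- The node `ξ_i = η_i = i h`. -/
def node (l : ℝ) (N i : ℕ) : ℝ := i * mesh l N

/-- The cell `[ξ_i, ξ_{i+1}] × [η_j, η_{j+1}]`. -/
def cell (l : ℝ) (N i j : ℕ) : Set (ℝ × ℝ) :=
  Icc (node l N i) (node l N (i + 1)) ×ˢ Icc (node l N j) (node l N (j + 1))

/-- The weight `(ξ² + η²)^{(γ - 2 - β)/2}`. -/
def weight (β γ : ℝ) (z : ℝ × ℝ) : ℝ := (z.1 ^ 2 + z.2 ^ 2) ^ ((γ - 2 - β) / 2)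

/-- `G_{0,0}`, the integral of the weight over the cell at the origin (without a factor `1/h²`). -/
def Gzero (β γ l : ℝ) (N : ℕ) : ℝ := ∫ z in cell l N 0 0, weight β γ z

/-- `G_{i,j}` for `(i,j) ≠ (0,0)`. -/
def G (β γ l : ℝ) (N i j : ℕ) : ℝ :=
  1 / mesh l N ^ 2 * ∫ z in cell l N i j, weight β γ z

/-- `G^ξ_{i,j}`. -/
def Gxi (β γ l : ℝ) (N i j : ℕ) : ℝ :=
  1 / mesh l N ^ 2 * ∫ z in cell l N i j, z.1 * weight β γ z

/-- `G^η_{i,j}`. -/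
def Geta (β γ l : ℝ) (N i j : ℕ) : ℝ :=
  1 / mesh l N ^ 2 * ∫ z in cell l N i j, z.2 * weight β γ z

/-- `G^{ξη}_{i,j}`. -/
def Gxieta (β γ l : ℝ) (N i j : ℕ) : ℝ :=
  1 / mesh l N ^ 2 * ∫ z in cell l N i j, z.1 * z.2 * weight β γ z

/-- `G^{ξη}_{i,j} - a G^η_{i,j} - b G^ξ_{i,j} + a b G_{i,j}`, i.e. `1/h²` times the integral of
`(ξ - a) (η - b)` against the weight over the cell `(i,j)`. -/
def moment (β γ l : ℝ) (N i j : ℕ) (a b : ℝ) : ℝ :=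
  Gxieta β γ l N i j - a * Geta β γ l N i j - b * Gxi β γ l N i j + a * b * G β γ l N i j

/-- Interpolation weight at the node `(i,j)` coming from the cell `(i,j)`. -/
def W1 (β γ l : ℝ) (N i j : ℕ) : ℝ :=
  moment β γ l N i j (node l N (i + 1)) (node l N (j + 1))

/-- Interpolation weight at the node `(i,j)` coming from the cell `(i-1,j)`; used for `1 ≤ i`. -/
def W2 (β γ l : ℝ) (N i j : ℕ) : ℝ :=
  -moment β γ l N (i - 1) j (node l N (i - 1)) (node l N (j + 1))

/-- Interpolation weight at the node `(i,j)` coming from the cell `(i,j-1)`; used for `1 ≤ j`. -/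
def W3 (β γ l : ℝ) (N i j : ℕ) : ℝ :=
  -moment β γ l N i (j - 1) (node l N (i + 1)) (node l N (j - 1))

/-- Interpolation weight at the node `(i,j)` coming from the cell `(i-1,j-1)`; used for
`1 ≤ i` and `1 ≤ j`. -/
def W4 (β γ l : ℝ) (N i j : ℕ) : ℝ :=
  moment β γ l N (i - 1) (j - 1) (node l N (i - 1)) (node l N (j - 1))

/-- `k_γ`, equal to `1` for `γ < 2` and to `4/3` for `γ = 2`. -/
def kGamma (γ : ℝ) : ℝ := if γ = 2 then 4 / 3 else 1

/-- The coefficient of `φ_γ(ξ_i, η_j)`, `0 ≤ i, j ≤ N`, `(i,j) ≠ (0,0)`, in the quadrature of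
`φ_γ` times the weight over `[0,L]²`: the weighted trapezoidal rule on the cell `(0,0)` and
bilinear interpolation on all other cells. -/
def quadCoeff (β γ l : ℝ) (N i j : ℕ) : ℝ :=
  if i = 1 ∧ j = 1 then
    kGamma γ / 4 * Gzero β γ l N + W1 β γ l N 1 1 + W2 β γ l N 1 1 + W3 β γ l N 1 1
  else if i = 1 ∧ j = 0 then kGamma γ / 4 * Gzero β γ l N + W1 β γ l N 1 0
  else if i = 0 ∧ j = 1 then kGamma γ / 4 * Gzero β γ l N + W1 β γ l N 0 1
  else if i = 0 ∧ j = N then W3 β γ l N 0 N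
  else if i = N ∧ j = 0 then W2 β γ l N N 0
  else if i = N ∧ j = N then W4 β γ l N N N
  else if j = 0 then W1 β γ l N i 0 + W2 β γ l N i 0
  else if i = 0 then W1 β γ l N 0 j + W3 β γ l N 0 j
  else if j = N then W3 β γ l N i N + W4 β γ l N i N
  else if i = N then W2 β γ l N N j + W4 β γ l N N j
  else W1 β γ l N i j + W2 β γ l N i j + W3 β γ l N i j + W4 β γ l N i j

/-- `quadCoeff` divided by `e^{lam r} r^γ` with `r = √(ξ_i² + η_j²)`. -/
def quadCoeffScaled (β lam γ l : ℝ) (N i j : ℕ) : ℝ :=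
  quadCoeff β γ l N i j /
    (exp (lam * eucl (node l N i, node l N j)) * eucl (node l N i, node l N j) ^ γ)

/-- `1 / (e^{lam r} r^{2 + β})` with `r = √(ξ² + η²)`. -/
def temperedKernel (β lam : ℝ) (z : ℝ × ℝ) : ℝ :=
  1 / (exp (lam * eucl z) * eucl z ^ (2 + β))

/-- `G^∞`, the integral of the tempered kernel over `[0,∞)² \ [0,L]²`, `L = 2 l`. -/
def Ginf (β lam l : ℝ) : ℝ :=
  (∫ z in Icc 0 (2 * l) ×ˢ Ioi (2 * l), temperedKernel β lam z) +
  (∫ z in Ioi (2 * l) ×ˢ Icc 0 (2 * l), temperedKernel β lam z) +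
  ∫ z in Ioi (2 * l) ×ˢ Ioi (2 * l), temperedKernel β lam z

/-- The weights `w_{i,j}`, `0 ≤ i, j ≤ N`, of the finite difference scheme
`-(Δ + lam)_h^{β/2} u_{p,q} = ∑_{|i| ≤ N} ∑_{|j| ≤ N} w_{|i|,|j|} u_{p-i,q-j}`. -/
def w (β lam γ l : ℝ) (N i j : ℕ) : ℝ :=
  -normConst 2 β lam *
    if i = 0 ∧ j = 0 then
      -4 * ((∑ p ∈ (Finset.range (N + 1) ×ˢ Finset.range (N + 1)).erase (0, 0),
        quadCoeffScaled β lam γ l N p.1 p.2) + Ginf β lam l)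
    else if i = 0 ∨ j = 0 then 2 * quadCoeffScaled β lam γ l N i j
    else quadCoeffScaled β lam γ l N i j

/-- The interior grid indices: `(a, b)` stands for the pair `(p, q) = (a + 1, b + 1)` with
`1 ≤ p, q ≤ N - 1`. -/
abbrev Idx (N : ℕ) : Type := Fin (N - 1) × Fin (N - 1)

/-- The stiffness matrix `B`, with entry `w_{|p - p'|, |q - q'|}` at `((p, q), (p', q'))`. -/
def stiffness (β lam γ l : ℝ) (N : ℕ) : Matrix (Idx N) (Idx N) ℝ :=
  fun s t => w β lam γ l N
    (Int.natAbs ((s.1 : ℤ) - (t.1 : ℤ))) (Int.natAbs ((s.2 : ℤ) - (t.2 : ℤ)))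

/-- The vector of the values of a function at the interior grid points `(-l + p h, -l + q h)`. -/
def gridValues (l : ℝ) (N : ℕ) (v : ℝ × ℝ → ℝ) : Idx N → ℝ :=
  fun s => v (-l + ((s.1 : ℝ) + 1) * mesh l N, -l + ((s.2 : ℝ) + 1) * mesh l N)

/-- The discrete `L²` norm on the planar grid, each grid point having the mass `h²` of a cell. -/
def discreteL2Norm (l : ℝ) (N : ℕ) (V : Idx N → ℝ) : ℝ :=
  √(mesh l N ^ 2 * ∑ s, V s ^ 2)

/-- The discrete `L^∞` norm, the maximum of the absolute values of the entries. -/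
def discreteLinftyNorm (N : ℕ) (V : Idx N → ℝ) : ℝ := ⨆ s, |V s|

/-- The supremum over the plane of the norm of the second derivative of `u`; it is finite when `u`
is `C²` and vanishes outside of a bounded set. -/
def secondDerivSup (u : ℝ × ℝ → ℝ) : ℝ := ⨆ z, ‖iteratedFDeriv ℝ 2 u z‖

end

end TemperedFD

/-! The estimate is consistency plus stability in the maximum norm.

Consistency (`truncation`): substituting y = x - z and folding the plane onto the first quadrant
turns the truncated integral into one of `symDiff4 u x z` times r^(-2-β) e^(-lam r). Odd terms
cancel, so `symDiff4` is at most 2|u|_2 r², and the quadrant splits into three regions. On [0,h]²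
the exact integral and the trapezoidal value are each O(|u|_2 h^(2-β)), so no cancellation between
them is needed. Outside [0,L]² all shifted points leave the domain and the term with G^∞ is exact.
In between, `phi` = `symDiff4` · e^(-lam r) r^(-γ) has pure second derivatives O(|u|_2 r^(-γ)),
because `symDiff4` and its first derivative vanish to the right order at the origin. Bilinear
interpolation therefore errs by O(|u|_2 h² r^(-γ)) (`abs_phi_sub_bilin_le`). Times the weight
r^(γ-2-β) this is O(|u|_2 h² r^(-2-β)), and integration over r ≥ h gives h^(2-β) again.

Stability (`abs_le_of_mulVec`): the quadrature coefficients are nonnegative, being integrals of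
nodal basis functions against a positive weight, and the tail G^∞ makes every row of B strictly
dominant. At an entry of V of largest modulus, |(BV)_s| ≥ 4cG^∞|V_s|. This gives unique solvability
and, applied to U - U_h, the maximum norm bound. The L² bound follows because the grid has total
mass at most (2l)². -/

namespace TemperedFD

noncomputable section

/-! ### Linear interpolation -/

/-- Adding M t²/2 makes `f` convex, and the claim is the chord inequality: the defect of t² itself
is (x - a)(b - x). Everything is multiplied by b - a to avoid quotients. -/
lemma sub_linear_interp_le {f f' f'' : ℝ → ℝ} {a b M x : ℝ} (hab : a < b) (hx : x ∈ Icc a b)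
    (hf : ∀ t ∈ Icc a b, HasDerivAt f (f' t) t) (hf' : ∀ t ∈ Icc a b, HasDerivAt f' (f'' t) t)
    (hM : ∀ t ∈ Icc a b, -M ≤ f'' t) :
    (b - a) * f x - ((b - x) * f a + (x - a) * f b) ≤ M / 2 * (b - a) * ((x - a) * (b - x)) := by
  have hconv : ConvexOn ℝ (Icc a b) (fun t => f t + M / 2 * t ^ 2) := by
    refine convexOn_of_hasDerivWithinAt2_nonneg (f' := fun t => f' t + M * t)
      (f'' := fun t => f'' t + M) (convex_Icc a b) ?_ ?_ ?_ ?_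
    · exact fun t ht => ((hf t ht).continuousAt.add (by fun_prop)).continuousWithinAt
    · intro t ht
      have h := (hf t (interior_subset ht)).add ((hasDerivAt_pow 2 t).const_mul (M / 2))
      refine HasDerivAt.hasDerivWithinAt (h.congr_deriv ?_)
      norm_num
      ring
    · intro t ht
      have h := (hf' t (interior_subset ht)).add ((hasDerivAt_id t).const_mul M)
      refine HasDerivAt.hasDerivWithinAt (h.congr_deriv ?_)
      ring
    · exact fun t ht => by linarith [hM t (interior_subset ht)]
  have hba : 0 < b - a := sub_pos.2 hab
  have h := hconv.2 (left_mem_Icc.2 hab.le) (right_mem_Icc.2 hab.le)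
    (div_nonneg (sub_nonneg.2 hx.2) hba.le) (div_nonneg (sub_nonneg.2 hx.1) hba.le)
    (by field_simp; ring)
  simp only [smul_eq_mul] at h
  have hxe : (b - x) / (b - a) * a + (x - a) / (b - a) * b = x := by field_simp; ring
  rw [hxe] at h
  have h2 := mul_le_mul_of_nonneg_left h hba.le
  have h3 : (b - a) * ((b - x) / (b - a) * (f a + M / 2 * a ^ 2) +
      (x - a) / (b - a) * (f b + M / 2 * b ^ 2)) =
      (b - x) * (f a + M / 2 * a ^ 2) + (x - a) * (f b + M / 2 * b ^ 2) := by
    field_simp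
  rw [h3] at h2
  linear_combination h2

lemma abs_sub_linear_interp_le {f f' f'' : ℝ → ℝ} {a b M x : ℝ} (hab : a < b) (hx : x ∈ Icc a b)
    (hf : ∀ t ∈ Icc a b, HasDerivAt f (f' t) t) (hf' : ∀ t ∈ Icc a b, HasDerivAt f' (f'' t) t)
    (hM : ∀ t ∈ Icc a b, |f'' t| ≤ M) :
    |(b - a) * f x - ((b - x) * f a + (x - a) * f b)| ≤
      M / 2 * (b - a) * ((x - a) * (b - x)) := by
  have h1 := sub_linear_interp_le hab hx hf hf' fun t ht => (abs_le.1 (hM t ht)).1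
  have h2 := sub_linear_interp_le (f := -f) (f' := -f') (f'' := -f'') (M := M) hab hx
    (fun t ht => (hf t ht).neg) (fun t ht => (hf' t ht).neg)
    fun t ht => neg_le_neg (abs_le.1 (hM t ht)).2
  simp only [Pi.neg_apply] at h2
  exact abs_le.2 ⟨by linarith, h1⟩

/-! ### Functions of the plane that are twice differentiable along horizontal lines -/

/-- On horizontal lines, `u` is twice differentiable with second derivative bounded by `A`. -/
def LineBound (A : ℝ) (u : ℝ × ℝ → ℝ) : Prop :=
  ∃ u₁ u₁₁ : ℝ → ℝ → ℝ, ∀ t y, HasDerivAt (fun s => u (s, y)) (u₁ t y) t ∧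
    HasDerivAt (fun s => u₁ s y) (u₁₁ t y) t ∧ |u₁₁ t y| ≤ A

lemma LineBound.nonneg {A : ℝ} {u : ℝ × ℝ → ℝ} (h : LineBound A u) : 0 ≤ A := by
  obtain ⟨u₁, u₁₁, h⟩ := h
  exact (abs_nonneg _).trans (h 0 0).2.2

/-- The second difference is the interpolation error at the midpoint of [x - t, x + t]; it is even
in t, so t > 0 suffices. -/
lemma LineBound.abs_second_diff_le {A : ℝ} {u : ℝ × ℝ → ℝ} (h : LineBound A u) (x y t : ℝ) :
    |2 * u (x, y) - u (x + t, y) - u (x - t, y)| ≤ A * t ^ 2 := by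
  have key : ∀ t, 0 < t → |2 * u (x, y) - u (x + t, y) - u (x - t, y)| ≤ A * t ^ 2 := by
    intro t ht
    obtain ⟨u₁, u₁₁, h⟩ := h
    have := abs_sub_linear_interp_le (f := fun s => u (s, y)) (a := x - t) (b := x + t) (x := x)
      (M := A) (by linarith) ⟨by linarith, by linarith⟩ (fun s _ => (h s y).1)
      (fun s _ => (h s y).2.1) fun s _ => (h s y).2.2
    have e : (x + t - (x - t)) * u (x, y) - ((x + t - x) * u (x - t, y) +
        (x - (x - t)) * u (x + t, y)) = t * (2 * u (x, y) - u (x + t, y) - u (x - t, y)) := by ring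
    simp only [e] at this
    rw [abs_mul, abs_of_pos ht] at this
    have : t * |2 * u (x, y) - u (x + t, y) - u (x - t, y)| ≤ t * (A * t ^ 2) :=
      this.trans (le_of_eq (by ring))
    exact le_of_mul_le_mul_left this ht
  rcases lt_trichotomy t 0 with ht | rfl | ht
  · have := key (-t) (by linarith)
    rw [neg_sq] at this
    convert this using 2
    ring_nf
  · rw [add_zero, sub_zero, two_mul]
    simp
  · exact key t ht

/-- The symmetrized difference `4 u(x) - ∑ u(x₁ ± z₁, x₂ ± z₂)`. -/
def symDiff4 (u : ℝ × ℝ → ℝ) (x z : ℝ × ℝ) : ℝ :=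
  4 * u x - (u (x.1 + z.1, x.2 + z.2) + u (x.1 - z.1, x.2 + z.2) +
    u (x.1 + z.1, x.2 - z.2) + u (x.1 - z.1, x.2 - z.2))

/-- Lets statements about horizontal lines be reused on vertical ones, through `u ∘ Prod.swap`. -/
lemma symDiff4_swap (u : ℝ × ℝ → ℝ) (x z : ℝ × ℝ) :
    symDiff4 (u ∘ Prod.swap) x.swap z.swap = symDiff4 u x z := by
  simp only [symDiff4, Function.comp, Prod.swap]
  ring

/-- The expression is the sum of the horizontal second differences at heights x₂ ± z₂ and twice the
vertical one at x, so no mixed derivative of `u` enters. -/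
lemma abs_symDiff4_le {A : ℝ} {u : ℝ × ℝ → ℝ} (h₁ : LineBound A u)
    (h₂ : LineBound A (u ∘ Prod.swap)) (x z : ℝ × ℝ) :
    |symDiff4 u x z| ≤ 2 * A * (z.1 ^ 2 + z.2 ^ 2) := by
  have a1 := abs_le.1 (h₁.abs_second_diff_le x.1 (x.2 + z.2) z.1)
  have a2 := abs_le.1 (h₁.abs_second_diff_le x.1 (x.2 - z.2) z.1)
  have a3 := abs_le.1 (h₂.abs_second_diff_le x.2 x.1 z.2)
  simp only [Function.comp, Prod.swap] at a3
  rw [symDiff4, abs_le]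
  constructor <;> linarith [a1.1, a1.2, a2.1, a2.2, a3.1, a3.2]

/-- The first derivative is made of differences of `u₁` at x₁ + t and x₁ - t, hence O(|t|) by the
mean value inequality. This decay pays for one derivative of the singular radial factor. -/
lemma LineBound.symDiff4_line {A : ℝ} {u : ℝ × ℝ → ℝ} (h : LineBound A u) (x : ℝ × ℝ) (η : ℝ) :
    ∃ g' g'' : ℝ → ℝ, ∀ t, HasDerivAt (fun s => symDiff4 u x (s, η)) (g' t) t ∧
      HasDerivAt g' (g'' t) t ∧ |g' t| ≤ 4 * A * |t| ∧ |g'' t| ≤ 4 * A := by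
  obtain ⟨u₁, u₁₁, h⟩ := h
  have lip : ∀ t y, |u₁ (x.1 + t) y - u₁ (x.1 - t) y| ≤ 2 * A * |t| := by
    intro t y
    have := Convex.norm_image_sub_le_of_norm_hasDerivWithin_le (f := fun s => u₁ s y)
      (f' := fun s => u₁₁ s y) (s := univ) (C := A) (x := x.1 - t) (y := x.1 + t)
      (fun s _ => (h s y).2.1.hasDerivWithinAt) (fun s _ => (h s y).2.2) convex_univ
      (mem_univ _) (mem_univ _)
    rw [Real.norm_eq_abs, Real.norm_eq_abs, show x.1 + t - (x.1 - t) = 2 * t by ring,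
      abs_mul, abs_two] at this
    linarith
  have hp : ∀ t, HasDerivAt (fun s => x.1 + s) 1 t := fun t => (hasDerivAt_id t).const_add _
  have hm : ∀ t, HasDerivAt (fun s => x.1 - s) (-1) t := fun t => (hasDerivAt_id t).const_sub _
  refine ⟨fun t => -(u₁ (x.1 + t) (x.2 + η) - u₁ (x.1 - t) (x.2 + η) + u₁ (x.1 + t) (x.2 - η)
      - u₁ (x.1 - t) (x.2 - η)),
    fun t => -(u₁₁ (x.1 + t) (x.2 + η) + u₁₁ (x.1 - t) (x.2 + η) + u₁₁ (x.1 + t) (x.2 - η)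
      + u₁₁ (x.1 - t) (x.2 - η)), fun t => ⟨?_, ?_, ?_, ?_⟩⟩
  · have c1 := (h (x.1 + t) (x.2 + η)).1.comp t (hp t)
    have c2 := (h (x.1 - t) (x.2 + η)).1.comp t (hm t)
    have c3 := (h (x.1 + t) (x.2 - η)).1.comp t (hp t)
    have c4 := (h (x.1 - t) (x.2 - η)).1.comp t (hm t)
    refine ((((c1.add c2).add c3).add c4).const_sub (4 * u x)).congr_deriv ?_
    ring
  · have c1 := (h (x.1 + t) (x.2 + η)).2.1.comp t (hp t)
    have c2 := (h (x.1 - t) (x.2 + η)).2.1.comp t (hm t)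
    have c3 := (h (x.1 + t) (x.2 - η)).2.1.comp t (hp t)
    have c4 := (h (x.1 - t) (x.2 - η)).2.1.comp t (hm t)
    refine (((c1.sub c2).add c3).sub c4).neg.congr_deriv ?_
    ring
  · have a1 := abs_le.1 (lip t (x.2 + η))
    have a2 := abs_le.1 (lip t (x.2 - η))
    rw [abs_le]
    constructor <;> linarith [a1.1, a1.2, a2.1, a2.2]
  · have a1 := abs_le.1 (h (x.1 + t) (x.2 + η)).2.2
    have a2 := abs_le.1 (h (x.1 - t) (x.2 + η)).2.2
    have a3 := abs_le.1 (h (x.1 + t) (x.2 - η)).2.2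
    have a4 := abs_le.1 (h (x.1 - t) (x.2 - η)).2.2
    rw [abs_le]
    constructor <;> linarith [a1.1, a1.2, a2.1, a2.2, a3.1, a3.2, a4.1, a4.2]

/-! ### The radial factor -/

/-- `e^{-lam r} r^{2p}` as a function of `s = r²`. -/
def radial (lam p s : ℝ) : ℝ := exp (-(lam * √s)) * s ^ p

/-- The first derivative of `radial`. -/
def radial' (lam p s : ℝ) : ℝ :=
  exp (-(lam * √s)) * (s ^ (p - 1) * (p - lam * √s / 2))

/-- The second derivative of `radial`. -/
def radial'' (lam p s : ℝ) : ℝ :=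
  exp (-(lam * √s)) * (s ^ (p - 2) *
    (p * (p - 1) - lam * √s / 2 * (p - 1 / 2) - lam * √s / 2 * p + (lam * √s) ^ 2 / 4))

lemma hasDerivAt_exp_sqrt (lam : ℝ) {s : ℝ} (hs : 0 < s) :
    HasDerivAt (fun s => exp (-(lam * √s))) (exp (-(lam * √s)) * (-(lam * √s / 2) * s⁻¹)) s := by
  have h := (((hasDerivAt_id s).sqrt hs.ne').const_mul lam).neg.exp
  refine h.congr_deriv ?_
  simp only [id, Pi.neg_apply]
  have : √s ≠ 0 := (sqrt_pos.2 hs).ne'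
  have e : s⁻¹ = (√s)⁻¹ * (√s)⁻¹ := by rw [← mul_inv, mul_self_sqrt hs.le]
  rw [e]
  field_simp

lemma hasDerivAt_radial (lam p : ℝ) {s : ℝ} (hs : 0 < s) :
    HasDerivAt (radial lam p) (radial' lam p s) s := by
  refine ((hasDerivAt_exp_sqrt lam hs).mul
    (hasDerivAt_rpow_const (p := p) (Or.inl hs.ne'))).congr_deriv ?_
  rw [radial', rpow_sub_one hs.ne']
  ring

lemma hasDerivAt_radial' (lam p : ℝ) {s : ℝ} (hs : 0 < s) :
    HasDerivAt (radial' lam p) (radial'' lam p s) s := by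
  have h1 := (((hasDerivAt_id s).sqrt hs.ne').const_mul lam).div_const 2 |>.const_sub p
  have h2 := (hasDerivAt_exp_sqrt lam hs).mul
    ((hasDerivAt_rpow_const (p := p - 1) (Or.inl hs.ne')).mul h1)
  refine h2.congr_deriv ?_
  rw [radial'', rpow_sub_one hs.ne' (p - 1), show p - 2 = p - 1 - 1 by ring,
    rpow_sub_one hs.ne' (p - 1)]
  simp only [id, Pi.mul_apply]
  have : √s ≠ 0 := (sqrt_pos.2 hs).ne'
  have e : s⁻¹ = (√s)⁻¹ * (√s)⁻¹ := by rw [← mul_inv, mul_self_sqrt hs.le]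
  rw [div_eq_mul_inv _ s, e]
  field_simp
  ring

lemma mul_exp_neg_le_one {t : ℝ} : t * exp (-t) ≤ 1 := by
  rw [exp_neg, ← div_eq_mul_inv, div_le_one (exp_pos t)]
  linarith [add_one_le_exp t]

lemma sq_mul_exp_neg_le_two {t : ℝ} (ht : 0 ≤ t) : t ^ 2 * exp (-t) ≤ 2 := by
  rw [exp_neg, ← div_eq_mul_inv, div_le_iff₀ (exp_pos t)]
  nlinarith [quadratic_le_exp_of_nonneg ht]

lemma radial_nonneg (lam p : ℝ) {s : ℝ} (hs : 0 ≤ s) : 0 ≤ radial lam p s :=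
  mul_nonneg (exp_pos _).le (rpow_nonneg hs _)

lemma radial_le {lam p s : ℝ} (hlam : 0 ≤ lam) (hs : 0 ≤ s) : radial lam p s ≤ s ^ p := by
  have : exp (-(lam * √s)) ≤ 1 := exp_le_one_iff.2 (by have := sqrt_nonneg s; nlinarith)
  exact mul_le_of_le_one_left (rpow_nonneg hs _) this

/-- With t = lam √s, the products t e^(-t) and t² e^(-t) are bounded. The derivatives thus scale
like those of s^p, with constants free of lam. -/
lemma abs_radial'_le {lam p s : ℝ} (hlam : 0 ≤ lam) (hp : -1 ≤ p) (hp0 : p ≤ 0) (hs : 0 < s) :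
    |radial' lam p s| ≤ 2 * s ^ (p - 1) := by
  have ht : 0 ≤ lam * √s := by positivity
  have he : exp (-(lam * √s)) ≤ 1 := exp_le_one_iff.2 (by linarith)
  have he0 := exp_pos (-(lam * √s))
  have h1 := mul_exp_neg_le_one (t := lam * √s)
  have hr : 0 ≤ s ^ (p - 1) := rpow_nonneg hs.le _
  rw [radial']
  set t := lam * √s
  have : |exp (-t) * (p - t / 2)| ≤ 2 := by
    rw [abs_le]
    constructor <;> nlinarith
  calc _ = s ^ (p - 1) * |exp (-t) * (p - t / 2)| := by
        rw [← abs_of_nonneg hr, ← abs_mul, abs_of_nonneg hr]; ring_nf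
    _ ≤ _ := by nlinarith

lemma abs_radial''_le {lam p s : ℝ} (hlam : 0 ≤ lam) (hp : -1 ≤ p) (hp0 : p ≤ 0) (hs : 0 < s) :
    |radial'' lam p s| ≤ 5 * s ^ (p - 2) := by
  have ht : 0 ≤ lam * √s := by positivity
  have he : exp (-(lam * √s)) ≤ 1 := exp_le_one_iff.2 (by linarith)
  have he0 := exp_pos (-(lam * √s))
  have h1 := mul_exp_neg_le_one (t := lam * √s)
  have h2 := sq_mul_exp_neg_le_two ht
  have hr : 0 ≤ s ^ (p - 2) := rpow_nonneg hs.le _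
  rw [radial'']
  set t := lam * √s
  set E := exp (-t)
  have : |E * (p * (p - 1) - t / 2 * (p - 1 / 2) - t / 2 * p + t ^ 2 / 4)| ≤ 5 := by
    -- In this grouping the summands are nonnegative and at most 2, 5/4 and 1/2.
    have e : E * (p * (p - 1) - t / 2 * (p - 1 / 2) - t / 2 * p + t ^ 2 / 4) =
      E * (p * (p - 1)) + (t * E) * (1 / 4 - p) + t ^ 2 * E / 4 := by ring
    have b0 : 0 ≤ p * (p - 1) := by nlinarith
    have b1 : p * (p - 1) ≤ 2 := by nlinarith
    have c0 : 0 ≤ E * (p * (p - 1)) := by positivity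
    have c1 : E * (p * (p - 1)) ≤ 2 := by nlinarith
    have d0 : 0 ≤ (t * E) * (1 / 4 - p) := mul_nonneg (by positivity) (by linarith)
    have d1 : (t * E) * (1 / 4 - p) ≤ 5 / 4 := by nlinarith [mul_nonneg ht he0.le]
    have e0 : 0 ≤ t ^ 2 * E := by positivity
    rw [e, abs_of_nonneg (by linarith)]
    linarith
  calc _ = s ^ (p - 2) * |E * (p * (p - 1) - t / 2 * (p - 1 / 2) - t / 2 * p + t ^ 2 / 4)| := by
        rw [← abs_of_nonneg hr, ← abs_mul, abs_of_nonneg hr]; ring_nf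
    _ ≤ _ := by nlinarith

/-! ### The function that is interpolated -/

/-- The squared Euclidean length. -/
def sq2 (z : ℝ × ℝ) : ℝ := z.1 ^ 2 + z.2 ^ 2

/-- The symmetrized difference times `e^{-lam r} r^{2p}`. -/
def phi (lam p : ℝ) (u : ℝ × ℝ → ℝ) (x z : ℝ × ℝ) : ℝ :=
  symDiff4 u x z * radial lam p (sq2 z)

lemma phi_swap (lam p : ℝ) (u : ℝ × ℝ → ℝ) (x z : ℝ × ℝ) :
    phi lam p (u ∘ Prod.swap) x.swap z.swap = phi lam p u x z := by
  rw [phi, symDiff4_swap, phi, sq2, sq2, Prod.fst_swap, Prod.snd_swap, add_comm (z.2 ^ 2)]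

/-- With s = r², `symDiff4` is O(s), its first derivative O(|t|) and its second O(1), while k
derivatives of `radial` in s cost s^(-k). As t² ≤ s, each term of the product rule is O(A s^p), and
84 = 4 + 32 + 48. The exponent in use is p = -γ/2. -/
lemma phi_line {A lam p : ℝ} {u : ℝ × ℝ → ℝ} (hlam : 0 ≤ lam) (hp : -1 ≤ p) (hp0 : p ≤ 0)
    (h₁ : LineBound A u) (h₂ : LineBound A (u ∘ Prod.swap)) (x : ℝ × ℝ) (η : ℝ) :
    ∃ f' f'' : ℝ → ℝ, ∀ t, 0 < sq2 (t, η) →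
      HasDerivAt (fun s => phi lam p u x (s, η)) (f' t) t ∧ HasDerivAt f' (f'' t) t ∧
        |f'' t| ≤ 84 * A * sq2 (t, η) ^ p := by
  obtain ⟨g', g'', hg⟩ := h₁.symDiff4_line x η
  have hA := h₁.nonneg
  have hs : ∀ t, HasDerivAt (fun s => sq2 (s, η)) (2 * t) t := fun t => by
    simpa [sq2] using ((hasDerivAt_pow 2 t).add_const (η ^ 2))
  refine ⟨fun t => g' t * radial lam p (sq2 (t, η)) +
      symDiff4 u x (t, η) * (radial' lam p (sq2 (t, η)) * (2 * t)),
    fun t => g'' t * radial lam p (sq2 (t, η)) + 2 * (g' t * (radial' lam p (sq2 (t, η)) * (2 * t)))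
      + symDiff4 u x (t, η) * (radial'' lam p (sq2 (t, η)) * (4 * t ^ 2) +
        2 * radial' lam p (sq2 (t, η))), fun t ht => ⟨?_, ?_, ?_⟩⟩
  · have r1 : HasDerivAt (fun s => radial lam p (sq2 (s, η))) _ t :=
      HasDerivAt.comp (h₂ := radial lam p) t (hasDerivAt_radial lam p ht) (hs t)
    exact (hg t).1.mul r1
  · have r1 : HasDerivAt (fun s => radial lam p (sq2 (s, η))) _ t :=
      HasDerivAt.comp (h₂ := radial lam p) t (hasDerivAt_radial lam p ht) (hs t)
    have r2 : HasDerivAt (fun s => radial' lam p (sq2 (s, η))) _ t :=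
      HasDerivAt.comp (h₂ := radial' lam p) t (hasDerivAt_radial' lam p ht) (hs t)
    refine (((hg t).2.1.mul r1).add ((hg t).1.mul
      (r2.mul ((hasDerivAt_id t).const_mul 2)))).congr_deriv ?_
    simp only [id, Pi.mul_apply]
    ring
  · obtain ⟨-, -, b1, b2⟩ := hg t
    have b0 : |symDiff4 u x (t, η)| ≤ 2 * A * sq2 (t, η) := abs_symDiff4_le h₁ h₂ x (t, η)
    have k0 := radial_le (p := p) hlam ht.le
    have k00 := radial_nonneg lam p ht.le
    have k1 := abs_radial'_le hlam hp hp0 ht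
    have k2 := abs_radial''_le hlam hp hp0 ht
    have hts : t ^ 2 ≤ sq2 (t, η) := by simp only [sq2]; nlinarith [sq_nonneg η]
    set s := sq2 (t, η)
    have e1 : s * s ^ (p - 1) = s ^ p := by rw [rpow_sub_one ht.ne']; field_simp
    have e2 : s ^ 2 * s ^ (p - 2) = s ^ p := by
      rw [show p - 2 = p - 1 - 1 by ring, rpow_sub_one ht.ne', rpow_sub_one ht.ne']; field_simp
    have n1 : 0 ≤ s ^ (p - 1) := rpow_nonneg ht.le _
    have n2 : 0 ≤ s ^ (p - 2) := rpow_nonneg ht.le _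
    have n0 : 0 ≤ s ^ p := rpow_nonneg ht.le _
    have t1 : |g'' t * radial lam p s| ≤ 4 * A * s ^ p := by
      rw [abs_mul, abs_of_nonneg k00]
      exact mul_le_mul b2 k0 k00 (by positivity)
    have t2 : |2 * (g' t * (radial' lam p s * (2 * t)))| ≤ 32 * A * s ^ p := by
      rw [abs_mul, abs_mul, abs_mul, abs_mul, abs_two]
      calc 2 * (|g' t| * (|radial' lam p s| * (2 * |t|)))
          ≤ 2 * ((4 * A * |t|) * (2 * s ^ (p - 1) * (2 * |t|))) := by gcongr
        _ = 32 * A * (|t| ^ 2 * s ^ (p - 1)) := by ring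
        _ ≤ 32 * A * (s * s ^ (p - 1)) := by rw [sq_abs]; gcongr
        _ = _ := by rw [e1]
    have t3 : |symDiff4 u x (t, η) * (radial'' lam p s * (4 * t ^ 2) + 2 * radial' lam p s)| ≤
        48 * A * s ^ p := by
      rw [abs_mul]
      have : |radial'' lam p s * (4 * t ^ 2) + 2 * radial' lam p s| ≤
          5 * s ^ (p - 2) * (4 * s) + 2 * (2 * s ^ (p - 1)) := by
        refine (abs_add_le _ _).trans ?_
        rw [abs_mul, abs_mul 2, abs_two, abs_of_nonneg (by positivity : 0 ≤ 4 * t ^ 2)]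
        gcongr
      calc _ ≤ 2 * A * s * (5 * s ^ (p - 2) * (4 * s) + 2 * (2 * s ^ (p - 1))) := by gcongr
        _ = 40 * A * (s ^ 2 * s ^ (p - 2)) + 8 * A * (s * s ^ (p - 1)) := by ring
        _ = _ := by rw [e1, e2]; ring
    calc _ ≤ _ := abs_add_three _ _ _
      _ ≤ 4 * A * s ^ p + 32 * A * s ^ p + 48 * A * s ^ p := by gcongr
      _ = _ := by ring

/-! ### Bilinear interpolation -/

/-- `h²` times the bilinear interpolant of `F` on the square with lower left corner `(a, b)` and
side `h`. -/
def bilin (F : ℝ × ℝ → ℝ) (a b h : ℝ) (z : ℝ × ℝ) : ℝ :=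
  F (a, b) * ((z.1 - (a + h)) * (z.2 - (b + h))) - F (a + h, b) * ((z.1 - a) * (z.2 - (b + h)))
    - F (a, b + h) * ((z.1 - (a + h)) * (z.2 - b)) + F (a + h, b + h) * ((z.1 - a) * (z.2 - b))

/-- Away from the origin a cell is no larger than its distance to 0: (a + h)² + (b + h)² ≤ 2(a² +
b²) + 4h² ≤ 6(a² + b²). So r^(-γ) is comparable at all points of one cell. -/
lemma sq2_le_of_mem_cell {a b h : ℝ} (ha : 0 ≤ a) (hb : 0 ≤ b) (hh : 0 ≤ h) (hab : h ^ 2 ≤ sq2 (a, b))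
    {z z' : ℝ × ℝ} (hz : z ∈ Icc a (a + h) ×ˢ Icc b (b + h))
    (hz' : z' ∈ Icc a (a + h) ×ˢ Icc b (b + h)) : sq2 z ≤ 6 * sq2 z' := by
  obtain ⟨⟨h1, h2⟩, h3, h4⟩ := hz
  obtain ⟨⟨h1', h2'⟩, h3', h4'⟩ := hz'
  simp only [sq2] at *
  nlinarith [sq_nonneg (a - h), sq_nonneg (b - h)]

lemma abs_phi_line_interp_le {A lam p : ℝ} {u : ℝ × ℝ → ℝ} (hlam : 0 ≤ lam) (hp : -1 ≤ p)
    (hp0 : p ≤ 0) (h₁ : LineBound A u) (h₂ : LineBound A (u ∘ Prod.swap)) (x : ℝ × ℝ)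
    {a h t η m : ℝ} (hh : 0 < h) (ht : t ∈ Icc a (a + h)) (hm : 0 < m)
    (hms : ∀ s ∈ Icc a (a + h), m ≤ sq2 (s, η)) :
    |h * phi lam p u x (t, η) - ((a + h - t) * phi lam p u x (a, η) +
      (t - a) * phi lam p u x (a + h, η))| ≤ 42 * A * m ^ p * h ^ 3 := by
  obtain ⟨f', f'', hf⟩ := phi_line hlam hp hp0 h₁ h₂ x η
  have hA := h₁.nonneg
  have := abs_sub_linear_interp_le (M := 84 * A * m ^ p) (by linarith) ht
    (fun s hs => (hf s (hm.trans_le (hms s hs))).1)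
    (fun s hs => (hf s (hm.trans_le (hms s hs))).2.1)
    (fun s hs => (hf s (hm.trans_le (hms s hs))).2.2.trans
      (mul_le_mul_of_nonneg_left (rpow_le_rpow_of_nonpos hm (hms s hs) hp0) (by positivity)))
  rw [add_sub_cancel_left] at this
  refine this.trans ?_
  have hx : (t - a) * (a + h - t) ≤ h * h := by nlinarith [ht.1, ht.2]
  have hmp : 0 ≤ m ^ p := rpow_nonneg hm.le _
  calc _ ≤ 84 * A * m ^ p / 2 * h * (h * h) := by gcongr
    _ = _ := by ring

/-- Bilinear interpolation is linear interpolation along the vertical segment through z, then along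
the bottom and top edges, so only pure second derivatives are needed. The constant is (42 + 42) · 6,
the 6 coming from the comparison within a cell. -/
lemma abs_phi_sub_bilin_le {A lam p : ℝ} {u : ℝ × ℝ → ℝ} (hlam : 0 ≤ lam) (hp : -1 ≤ p)
    (hp0 : p ≤ 0) (h₁ : LineBound A u) (h₂ : LineBound A (u ∘ Prod.swap)) (x : ℝ × ℝ)
    {a b h : ℝ} (ha : 0 ≤ a) (hb : 0 ≤ b) (hh : 0 < h) (hab : h ^ 2 ≤ sq2 (a, b))
    {z : ℝ × ℝ} (hz : z ∈ Icc a (a + h) ×ˢ Icc b (b + h)) :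
    |phi lam p u x z - bilin (phi lam p u x) a b h z / h ^ 2| ≤ 504 * A * h ^ 2 * sq2 z ^ p := by
  have hA := h₁.nonneg
  obtain ⟨t, η⟩ := z
  have hs0 : 0 < sq2 (t, η) := by
    have h1 := hz.1.1
    have h2 := hz.2.1
    have : sq2 (a, b) ≤ sq2 (t, η) := by simp only [sq2]; gcongr
    nlinarith
  have hm : 0 < sq2 (t, η) / 6 := by positivity
  have hle : ∀ z' ∈ Icc a (a + h) ×ˢ Icc b (b + h), sq2 (t, η) / 6 ≤ sq2 z' := fun z' hz' => by
    linarith [sq2_le_of_mem_cell ha hb hh.le hab hz hz']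
  have hmp : (sq2 (t, η) / 6) ^ p ≤ 6 * sq2 (t, η) ^ p := by
    rw [div_rpow hs0.le (by norm_num), div_eq_mul_inv, ← rpow_neg (by norm_num), mul_comm]
    gcongr
    calc (6 : ℝ) ^ (-p) ≤ 6 ^ (1 : ℝ) := rpow_le_rpow_of_exponent_le (by norm_num) (by linarith)
      _ = 6 := rpow_one _
  have hbl : b ∈ Icc b (b + h) := ⟨le_rfl, by linarith⟩
  have hbr : b + h ∈ Icc b (b + h) := ⟨by linarith, le_rfl⟩
  have i1 := abs_phi_line_interp_le hlam hp hp0 h₁ h₂ x (η := b) hh hz.1 hm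
    fun s hs => hle (s, b) ⟨hs, hbl⟩
  have i2 := abs_phi_line_interp_le hlam hp hp0 h₁ h₂ x (η := b + h) hh hz.1 hm
    fun s hs => hle (s, b + h) ⟨hs, hbr⟩
  have i3 := abs_phi_line_interp_le (u := u ∘ Prod.swap) hlam hp hp0 h₂
    (by simpa [Function.comp_assoc] using h₁) x.swap (η := t) hh hz.2 hm fun s hs => by simpa [sq2, add_comm] using hle (t, s) ⟨hz.1, hs⟩
  have sw : ∀ s, phi lam p (u ∘ Prod.swap) x.swap (s, t) = phi lam p u x (t, s) :=
    fun s => phi_swap lam p u x (t, s)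
  rw [sw, sw, sw] at i3
  set Q := (sq2 (t, η) / 6) ^ p
  set φ := phi lam p u x
  obtain ⟨⟨z1, z2⟩, z3, z4⟩ := hz
  simp only at z1 z2 z3 z4 i3
  have hQ : 0 ≤ Q := rpow_nonneg hm.le _
  have key : |h ^ 2 * φ (t, η) - bilin φ a b h (t, η)| ≤ 84 * A * Q * h ^ 4 := by
    -- The last two errors carry weights b + h - η and η - b that add up to h.
    have e : h ^ 2 * φ (t, η) - bilin φ a b h (t, η) =
        h * (h * φ (t, η) - ((b + h - η) * φ (t, b) + (η - b) * φ (t, b + h))) +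
        (b + h - η) * (h * φ (t, b) - ((a + h - t) * φ (a, b) + (t - a) * φ (a + h, b))) +
        (η - b) * (h * φ (t, b + h) -
          ((a + h - t) * φ (a, b + h) + (t - a) * φ (a + h, b + h))) := by
      simp only [bilin]
      ring
    rw [e]
    refine (abs_add_three _ _ _).trans ?_
    rw [abs_mul, abs_mul, abs_mul, abs_of_pos hh, abs_of_nonneg (by linarith : 0 ≤ b + h - η),
      abs_of_nonneg (by linarith : 0 ≤ η - b)]
    calc _ ≤ h * (42 * A * Q * h ^ 3) + (b + h - η) * (42 * A * Q * h ^ 3) +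
          (η - b) * (42 * A * Q * h ^ 3) := by
          gcongr
      _ = _ := by ring
  have e : φ (t, η) - bilin φ a b h (t, η) / h ^ 2 =
      (h ^ 2 * φ (t, η) - bilin φ a b h (t, η)) / h ^ 2 := by field_simp
  rw [e, abs_div, abs_of_pos (by positivity : 0 < h ^ 2), div_le_iff₀ (by positivity)]
  calc _ ≤ _ := key
    _ ≤ 84 * A * (6 * sq2 (t, η) ^ p) * h ^ 4 := by gcongr
    _ = _ := by ring

/-! ### Line bounds of a compactly supported `C²` function -/

/-- Compact support bounds the range of the norm; without boundedness the real `⨆` would be the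
default 0. -/
lemma norm_iteratedFDeriv_le_secondDerivSup {u : ℝ × ℝ → ℝ} (hu : ContDiff ℝ 2 u)
    (hc : HasCompactSupport u) (z : ℝ × ℝ) : ‖iteratedFDeriv ℝ 2 u z‖ ≤ secondDerivSup u := by
  have h1 : Continuous fun z => ‖iteratedFDeriv ℝ 2 u z‖ :=
    (hu.continuous_iteratedFDeriv (m := 2) (by norm_num)).norm
  exact le_ciSup (h1.bddAbove_range_of_hasCompactSupport (hc.iteratedFDeriv 2).norm) z

lemma hasDerivAt_line {F : ℝ × ℝ → ℝ} {v w : ℝ × ℝ} (t : ℝ)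
    (hF : DifferentiableAt ℝ F (w + t • v)) :
    HasDerivAt (fun s => F (w + s • v)) (fderiv ℝ F (w + t • v) v) t := by
  have h1 : HasDerivAt (fun s : ℝ => w + s • v) v t := by
    simpa using ((hasDerivAt_id t).smul_const v).const_add w
  exact hF.hasFDerivAt.comp_hasDerivAt t h1

lemma lines_of_contDiff {u : ℝ × ℝ → ℝ} (hu : ContDiff ℝ 2 u)
    (hc : HasCompactSupport u) {v : ℝ × ℝ} (hv : ‖v‖ ≤ 1) (w : ℝ × ℝ) (t : ℝ) :
    HasDerivAt (fun s => u (w + s • v)) (fderiv ℝ u (w + t • v) v) t ∧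
    HasDerivAt (fun s => fderiv ℝ u (w + s • v) v)
      (fderiv ℝ (fderiv ℝ u) (w + t • v) v v) t ∧
    |fderiv ℝ (fderiv ℝ u) (w + t • v) v v| ≤ secondDerivSup u := by
  have hd : Differentiable ℝ u := hu.differentiable (by norm_num)
  have hd' : Differentiable ℝ (fderiv ℝ u) :=
    (hu.fderiv_right (m := 1) (by norm_num)).differentiable (by norm_num)
  refine ⟨hasDerivAt_line t (hd _), ?_, ?_⟩
  · have h1 := hasDerivAt_line (F := fun z => fderiv ℝ u z v) (v := v) (w := w) t
      ((hd' _).clm_apply (differentiableAt_const v))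
    refine h1.congr_deriv ?_
    rw [fderiv_clm_apply (hd' _) (differentiableAt_const v)]
    simp
  · have h := (iteratedFDeriv ℝ 2 u (w + t • v)).le_opNorm ![v, v]
    rw [iteratedFDeriv_two_apply] at h
    simp only [Matrix.cons_val_zero, Matrix.cons_val_one, Fin.prod_univ_two, Real.norm_eq_abs] at h
    refine h.trans ?_
    calc _ ≤ secondDerivSup u * (1 * 1) := by
          gcongr
          · exact (norm_nonneg _).trans (norm_iteratedFDeriv_le_secondDerivSup hu hc 0)
          · exact norm_iteratedFDeriv_le_secondDerivSup hu hc _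
      _ = _ := by ring

lemma lineBound_of_contDiff {u : ℝ × ℝ → ℝ} (hu : ContDiff ℝ 2 u) (hc : HasCompactSupport u) :
    LineBound (secondDerivSup u) u := by
  refine ⟨fun t y => fderiv ℝ u ((0, y) + t • (1, 0)) (1, 0),
    fun t y => fderiv ℝ (fderiv ℝ u) ((0, y) + t • (1, 0)) (1, 0) (1, 0), fun t y => ?_⟩
  simpa using lines_of_contDiff hu hc (v := (1, 0)) (by simp) (0, y) t

lemma lineBound_swap_of_contDiff {u : ℝ × ℝ → ℝ} (hu : ContDiff ℝ 2 u)
    (hc : HasCompactSupport u) : LineBound (secondDerivSup u) (u ∘ Prod.swap) := by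
  refine ⟨fun t y => fderiv ℝ u ((y, 0) + t • (0, 1)) (0, 1),
    fun t y => fderiv ℝ (fderiv ℝ u) ((y, 0) + t • (0, 1)) (0, 1) (0, 1), fun t y => ?_⟩
  simpa using lines_of_contDiff hu hc (v := (0, 1)) (by simp) (y, 0) t

/-! ### The stencil form of the matrix -/

/-- The weight of the index `i ≥ 0` in a sum over `±i`. -/
def halfZero (i : ℕ) : ℝ := if i = 0 then 1 / 2 else 1

/-- The points p ± i run through the interval once each, except that i = 0 hits p twice; hence the
half. -/
lemma sum_range_symm (g : ℤ → ℝ) (p : ℤ) (M : ℕ) :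
    ∑ i ∈ Finset.range (M + 1), halfZero i * (g (p + i) + g (p - i)) =
      ∑ m ∈ Finset.Icc (p - M) (p + M), g m := by
  induction M with
  | zero => simp [halfZero]; ring
  | succ M ih =>
    rw [Finset.sum_range_succ, ih]
    have e : Finset.Icc (p - (M + 1 : ℕ)) (p + (M + 1 : ℕ)) =
        insert (p + (M + 1 : ℕ)) (insert (p - (M + 1 : ℕ)) (Finset.Icc (p - M) (p + M))) := by
      ext m
      simp only [Finset.mem_insert, Finset.mem_Icc]
      push_cast
      omega
    rw [e, Finset.sum_insert, Finset.sum_insert]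
    · simp only [halfZero, Nat.succ_ne_zero, if_false]
      ring
    · simp only [Finset.mem_Icc]
      push_cast
      omega
    · simp only [Finset.mem_insert, Finset.mem_Icc]
      push_cast
      omega

/-- Since `F` vanishes off [0, n), the sum may be extended to [p - M, p + M], which contains [0, n)
as n ≤ M; it is then folded about p. -/
lemma sum_fin_toeplitz {n M : ℕ} (hM : n ≤ M) (W : ℕ → ℝ) (F : ℤ → ℝ)
    (hF : ∀ m : ℤ, ¬(0 ≤ m ∧ m < n) → F m = 0) (p : Fin n) :
    ∑ q : Fin n, W (Int.natAbs ((p : ℤ) - (q : ℤ))) * F q =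
      ∑ i ∈ Finset.range (M + 1), halfZero i * (W i * (F (p + i) + F (p - i))) := by
  have h1 := sum_range_symm (fun m => W (Int.natAbs ((p : ℤ) - m)) * F m) p M
  have h2 : ∀ i : ℕ, Int.natAbs ((p : ℤ) - (p + i)) = i := fun i => by omega
  have h3 : ∀ i : ℕ, Int.natAbs ((p : ℤ) - (p - i)) = i := fun i => by omega
  simp only [h2, h3, ← mul_add] at h1
  rw [h1]
  have h4 := Fin.sum_univ_eq_sum_range (fun q : ℕ => W (Int.natAbs ((p : ℤ) - (q : ℤ))) * F q) n
  have h5 := Finset.sum_map (Finset.range n) Nat.castEmbedding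
    (fun m : ℤ => W (Int.natAbs ((p : ℤ) - m)) * F m)
  simp only [Nat.castEmbedding_apply] at h5
  rw [h4, ← h5]
  have hp := p.2
  refine Finset.sum_subset ?_ ?_
  · intro m hm
    simp only [Finset.mem_map, Finset.mem_range, Nat.castEmbedding_apply] at hm
    obtain ⟨q, hq, rfl⟩ := hm
    rw [Finset.mem_Icc]
    omega
  · intro m _ hm
    rw [hF, mul_zero]
    rintro ⟨h0, hn⟩
    refine hm (Finset.mem_map.2 ⟨m.toNat, Finset.mem_range.2 (by omega), ?_⟩)
    simp [h0]

/-- Extension by zero of a grid function to all integer index pairs. -/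
def extendZero {N : ℕ} (V : Idx N → ℝ) (m n : ℤ) : ℝ :=
  if h : (0 ≤ m ∧ m < (N - 1 : ℕ)) ∧ (0 ≤ n ∧ n < (N - 1 : ℕ)) then
    V (⟨m.toNat, by omega⟩, ⟨n.toNat, by omega⟩) else 0

lemma extendZero_coe {N : ℕ} (V : Idx N → ℝ) (s : Idx N) :
    extendZero V (s.1 : ℤ) (s.2 : ℤ) = V s := by
  obtain ⟨⟨a, ha⟩, ⟨b, hb⟩⟩ := s
  simp [extendZero, ha, hb]

lemma abs_extendZero_le {N : ℕ} {V : Idx N → ℝ} {K : ℝ} (hK : 0 ≤ K) (h : ∀ s, |V s| ≤ K)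
    (m n : ℤ) : |extendZero V m n| ≤ K := by
  unfold extendZero
  split_ifs
  · exact h _
  · simpa using hK

/-- The sum of the values of a grid function at the four index pairs `s + (±i, ±j)`. -/
def fourSum {N : ℕ} (V : Idx N → ℝ) (s : Idx N) (p : ℕ × ℕ) : ℝ :=
  extendZero V (s.1 + p.1) (s.2 + p.2) + extendZero V (s.1 - p.1) (s.2 + p.2) +
    extendZero V (s.1 + p.1) (s.2 - p.2) + extendZero V (s.1 - p.1) (s.2 - p.2)

lemma sum_toeplitz {N : ℕ} (W : ℕ → ℕ → ℝ) (V : Idx N → ℝ) (s : Idx N) :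
    ∑ t : Idx N, W (Int.natAbs ((s.1 : ℤ) - (t.1 : ℤ))) (Int.natAbs ((s.2 : ℤ) - (t.2 : ℤ))) * V t =
      ∑ p ∈ Finset.range (N + 1) ×ˢ Finset.range (N + 1),
        halfZero p.1 * halfZero p.2 * W p.1 p.2 * fourSum V s p := by
  rw [Fintype.sum_prod_type, Finset.sum_product_right]
  have inner : ∀ a : Fin (N - 1), ∑ b : Fin (N - 1), W (Int.natAbs ((s.1 : ℤ) - (a : ℤ)))
      (Int.natAbs ((s.2 : ℤ) - (b : ℤ))) * V (a, b) = ∑ j ∈ Finset.range (N + 1), halfZero j *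
        (W (Int.natAbs ((s.1 : ℤ) - (a : ℤ))) j *
        (extendZero V a (s.2 + j) + extendZero V a (s.2 - j))) := by
    intro a
    rw [← sum_fin_toeplitz (Nat.sub_le N 1) (W (Int.natAbs ((s.1 : ℤ) - (a : ℤ))))
      (fun m => extendZero V a m) _ s.2]
    · exact Finset.sum_congr rfl fun b _ => by rw [← extendZero_coe V (a, b)]
    · exact fun m hm => dif_neg fun h => hm h.2
  simp only [inner]
  rw [Finset.sum_comm]
  refine Finset.sum_congr rfl fun j _ => ?_
  have h := sum_fin_toeplitz (Nat.sub_le N 1) (fun i => W i j)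
    (fun m => extendZero V m (s.2 + j) + extendZero V m (s.2 - j)) (fun m hm => by
      have : ∀ n, extendZero V m n = 0 := fun n => dif_neg fun h => hm h.1
      simp [this]) s.1
  rw [← Finset.mul_sum, h, Finset.mul_sum]
  refine Finset.sum_congr rfl fun i _ => ?_
  simp only [fourSum]
  ring

/-- The halves of `halfZero` cancel the factor 2 of `w` on the axes, and 1/4 cancels against
`fourSum` = 4V at the origin. The result serves both the maximum principle and the comparison with
`symDiff4`. -/
lemma stiffness_mulVec (β lam γ l : ℝ) (N : ℕ) (V : Idx N → ℝ) (s : Idx N) :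
    (stiffness β lam γ l N).mulVec V s = normConst 2 β lam * (4 * Ginf β lam l * V s +
      ∑ p ∈ (Finset.range (N + 1) ×ˢ Finset.range (N + 1)).erase (0, 0),
        quadCoeffScaled β lam γ l N p.1 p.2 * (4 * V s - fourSum V s p)) := by
  have h : (stiffness β lam γ l N).mulVec V s = _ := sum_toeplitz (w β lam γ l N) V s
  rw [h, ← Finset.add_sum_erase _ _ (a := (0, 0)) (by simp)]
  have h0 : fourSum V s (0, 0) = 4 * V s := by
    have := extendZero_coe V s
    simp only [fourSum, Nat.cast_zero, add_zero, sub_zero, this]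
    ring
  rw [h0]
  have h1 : ∀ p ∈ (Finset.range (N + 1) ×ˢ Finset.range (N + 1)).erase (0, 0),
      halfZero p.1 * halfZero p.2 * w β lam γ l N p.1 p.2 * fourSum V s p =
      -normConst 2 β lam * (quadCoeffScaled β lam γ l N p.1 p.2 * fourSum V s p) := by
    intro p hp
    have hp0 : ¬(p.1 = 0 ∧ p.2 = 0) := fun h => (Finset.mem_erase.1 hp).1 (Prod.ext h.1 h.2)
    simp only [w, halfZero, if_neg hp0]
    by_cases h1 : p.1 = 0
    · have h2 : p.2 ≠ 0 := fun h => hp0 ⟨h1, h⟩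
      simp only [h1, h2, if_true, if_false, true_or]
      ring
    · by_cases h2 : p.2 = 0
      · simp only [h1, h2, if_true, if_false, or_true]
        ring
      · simp only [h1, h2, if_false, or_self]
        ring
  rw [Finset.sum_congr rfl h1, ← Finset.mul_sum]
  simp only [mul_sub, Finset.sum_sub_distrib, ← Finset.sum_mul]
  simp only [w, halfZero, and_self, if_true]
  ring

/-! ### Stability -/

/-- Discrete maximum principle: where |V| is largest, every 4V - `fourSum` has the sign of V, so the
sum with nonnegative coefficients can only reinforce 4G^∞V. -/
lemma abs_le_of_mulVec {β lam γ l R : ℝ} {N : ℕ} (hc : 0 < normConst 2 β lam)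
    (hG : 0 < Ginf β lam l)
    (hq : ∀ p ∈ (Finset.range (N + 1) ×ˢ Finset.range (N + 1)).erase (0, 0),
      0 ≤ quadCoeffScaled β lam γ l N p.1 p.2)
    (V : Idx N → ℝ) (hR : ∀ s, |(stiffness β lam γ l N).mulVec V s| ≤ R) (s : Idx N) :
    |V s| ≤ R / (4 * normConst 2 β lam * Ginf β lam l) := by
  have : Nonempty (Idx N) := ⟨s⟩
  obtain ⟨m, hm⟩ := Finite.exists_max fun t => |V t|
  refine (hm s).trans ?_
  rw [le_div_iff₀ (by positivity)]
  refine le_trans ?_ (hR m)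
  have hfour : ∀ p, |fourSum V m p| ≤ 4 * |V m| := by
    intro p
    have h := fun a b => abs_le.1 (abs_extendZero_le (abs_nonneg (V m)) hm a b)
    have h1 := h (m.1 + p.1) (m.2 + p.2)
    have h2 := h (m.1 - p.1) (m.2 + p.2)
    have h3 := h (m.1 + p.1) (m.2 - p.2)
    have h4 := h (m.1 - p.1) (m.2 - p.2)
    rw [fourSum, abs_le]
    constructor <;> linarith [h1.1, h1.2, h2.1, h2.2, h3.1, h3.2, h4.1, h4.2]
  rw [stiffness_mulVec, abs_mul, abs_of_pos hc]
  have : 4 * Ginf β lam l * |V m| ≤ |4 * Ginf β lam l * V m +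
      ∑ p ∈ (Finset.range (N + 1) ×ˢ Finset.range (N + 1)).erase (0, 0),
        quadCoeffScaled β lam γ l N p.1 p.2 * (4 * V m - fourSum V m p)| := by
    rcases le_total 0 (V m) with h | h
    · have hs := Finset.sum_nonneg fun p hp => mul_nonneg (hq p hp)
        (by have := (abs_le.1 (hfour p)).2; rw [abs_of_nonneg h] at this; linarith :
          0 ≤ 4 * V m - fourSum V m p)
      rw [abs_of_nonneg h]
      exact le_trans (by linarith) (le_abs_self _)
    · have hs := Finset.sum_nonneg fun p hp => mul_nonneg (hq p hp)
        (by have := (abs_le.1 (hfour p)).1; rw [abs_of_nonpos h] at this; linarith :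
          0 ≤ -(4 * V m - fourSum V m p))
      simp only [mul_neg, Finset.sum_neg_distrib] at hs
      rw [abs_of_nonpos h]
      exact le_trans (by linarith) (neg_le_abs _)
  nlinarith

/-- The stability bound with R = 0 gives injectivity, which for a square matrix is bijectivity. -/
lemma existsUnique_mulVec {β lam γ l : ℝ} {N : ℕ} (hc : 0 < normConst 2 β lam)
    (hG : 0 < Ginf β lam l)
    (hq : ∀ p ∈ (Finset.range (N + 1) ×ˢ Finset.range (N + 1)).erase (0, 0),
      0 ≤ quadCoeffScaled β lam γ l N p.1 p.2) (F : Idx N → ℝ) :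
    ∃! U : Idx N → ℝ, (stiffness β lam γ l N).mulVec U = F := by
  have hinj : Function.Injective (stiffness β lam γ l N).mulVec := by
    intro U V h
    have h0 : (stiffness β lam γ l N).mulVec (U - V) = 0 := by
      rw [Matrix.mulVec_sub, h, sub_self]
    funext s
    have := abs_le_of_mulVec (R := 0) hc hG hq (U - V) (fun s => by simp [h0]) s
    rw [zero_div] at this
    exact sub_eq_zero.1 (abs_nonpos_iff.1 this)
  have hsurj : Function.Surjective (stiffness β lam γ l N).mulVec :=
    LinearMap.injective_iff_surjective (f := (stiffness β lam γ l N).mulVecLin) |>.1 hinj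
  exact Function.Bijective.existsUnique ⟨hinj, hsurj⟩ F

/-! ### The quadrature rule as a sum over cells -/

/-- The case table collects, at each node, the contributions of the adjacent cells; the excluded
indices are those whose cell would be (0,0). With N ≥ 2 the index 1 is not on the outer boundary,
where the table would be ambiguous. -/
lemma quadCoeff_eq {β γ l : ℝ} {N i j : ℕ} (hN : 2 ≤ N) (hi : i ≤ N) (hj : j ≤ N)
    (h0 : ¬(i = 0 ∧ j = 0)) :
    quadCoeff β γ l N i j =
      (if (i = 0 ∧ j = 1) ∨ (i = 1 ∧ j = 1) ∨ (i = 1 ∧ j = 0) then kGamma γ / 4 * Gzero β γ l N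
        else 0) +
      (if i < N ∧ j < N then W1 β γ l N i j else 0) +
      (if 1 ≤ i ∧ j < N ∧ ¬(i = 1 ∧ j = 0) then W2 β γ l N i j else 0) +
      (if i < N ∧ 1 ≤ j ∧ ¬(i = 0 ∧ j = 1) then W3 β γ l N i j else 0) +
      (if 1 ≤ i ∧ 1 ≤ j ∧ ¬(i = 1 ∧ j = 1) then W4 β γ l N i j else 0) := by
  unfold quadCoeff
  grind (splits := 30)

lemma sum_range_succ_of_last {N : ℕ} {f : ℕ → ℝ} (h : f N = 0) :
    ∑ i ∈ Finset.range (N + 1), f i = ∑ i ∈ Finset.range N, f i := by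
  rw [Finset.sum_range_succ, h, add_zero]

lemma sum_range_succ_of_first {N : ℕ} {f : ℕ → ℝ} (h : f 0 = 0) :
    ∑ i ∈ Finset.range (N + 1), f i = ∑ i ∈ Finset.range N, f (i + 1) := by
  rw [Finset.sum_range_succ', h, add_zero]

/-- Passage from a sum over nodes to a sum over cells: the parts with `W2`, `W3`, `W4` are shifted
by one in the first, the second or both indices. -/
lemma sum_quadCoeff {β γ l : ℝ} {N : ℕ} (hN : 2 ≤ N) (φ : ℕ → ℕ → ℝ) :
    ∑ p ∈ (Finset.range (N + 1) ×ˢ Finset.range (N + 1)).erase (0, 0),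
        quadCoeff β γ l N p.1 p.2 * φ p.1 p.2 =
      kGamma γ / 4 * Gzero β γ l N * (φ 0 1 + φ 1 1 + φ 1 0) +
      ∑ p ∈ (Finset.range N ×ˢ Finset.range N).erase (0, 0),
        (W1 β γ l N p.1 p.2 * φ p.1 p.2 + W2 β γ l N (p.1 + 1) p.2 * φ (p.1 + 1) p.2 +
          W3 β γ l N p.1 (p.2 + 1) * φ p.1 (p.2 + 1) +
          W4 β γ l N (p.1 + 1) (p.2 + 1) * φ (p.1 + 1) (p.2 + 1)) := by
  set K := kGamma γ / 4 * Gzero β γ l N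
  have hl : ∀ p ∈ (Finset.range (N + 1) ×ˢ Finset.range (N + 1)).erase (0, 0),
      quadCoeff β γ l N p.1 p.2 * φ p.1 p.2 =
      (if p.1 = 0 ∧ p.2 = 1 then K * φ p.1 p.2 else 0) +
      (if p.1 = 1 ∧ p.2 = 1 then K * φ p.1 p.2 else 0) +
      (if p.1 = 1 ∧ p.2 = 0 then K * φ p.1 p.2 else 0) +
      (if p.1 < N ∧ p.2 < N ∧ ¬(p.1 = 0 ∧ p.2 = 0) then W1 β γ l N p.1 p.2 * φ p.1 p.2 else 0) +
      (if 1 ≤ p.1 ∧ p.2 < N ∧ ¬(p.1 = 1 ∧ p.2 = 0) then W2 β γ l N p.1 p.2 * φ p.1 p.2 else 0) +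
      (if p.1 < N ∧ 1 ≤ p.2 ∧ ¬(p.1 = 0 ∧ p.2 = 1) then W3 β γ l N p.1 p.2 * φ p.1 p.2 else 0) +
      (if 1 ≤ p.1 ∧ 1 ≤ p.2 ∧ ¬(p.1 = 1 ∧ p.2 = 1) then W4 β γ l N p.1 p.2 * φ p.1 p.2
        else 0) := by
    rintro ⟨i, j⟩ hp
    simp only [Finset.mem_erase, Finset.mem_product, Finset.mem_range, ne_eq, Prod.mk.injEq] at hp
    rw [quadCoeff_eq hN (by omega) (by omega) hp.1]
    have h0 := hp.1
    simp only
    grind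
  have hr : ∀ p ∈ (Finset.range N ×ˢ Finset.range N).erase (0, 0),
      W1 β γ l N p.1 p.2 * φ p.1 p.2 + W2 β γ l N (p.1 + 1) p.2 * φ (p.1 + 1) p.2 +
          W3 β γ l N p.1 (p.2 + 1) * φ p.1 (p.2 + 1) +
          W4 β γ l N (p.1 + 1) (p.2 + 1) * φ (p.1 + 1) (p.2 + 1) =
      if ¬(p.1 = 0 ∧ p.2 = 0) then
        W1 β γ l N p.1 p.2 * φ p.1 p.2 + W2 β γ l N (p.1 + 1) p.2 * φ (p.1 + 1) p.2 +
          W3 β γ l N p.1 (p.2 + 1) * φ p.1 (p.2 + 1) +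
          W4 β γ l N (p.1 + 1) (p.2 + 1) * φ (p.1 + 1) (p.2 + 1) else 0 := by
    rintro ⟨i, j⟩ hp
    rw [if_pos]
    exact fun h => (Finset.mem_erase.1 hp).1 (Prod.ext h.1 h.2)
  rw [Finset.sum_congr rfl hl, Finset.sum_congr rfl hr, Finset.sum_erase _ (by simp),
    Finset.sum_erase _ (by simp)]
  simp only [Finset.sum_add_distrib, Finset.sum_product]
  have point : ∀ a b, a ≤ N → b ≤ N → ∑ i ∈ Finset.range (N + 1), ∑ j ∈ Finset.range (N + 1),
      (if i = a ∧ j = b then K * φ i j else 0) = K * φ a b := by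
    intro a b ha hb
    rw [Finset.sum_eq_single a, Finset.sum_eq_single b]
    · simp
    · intro j _ hj; simp [hj]
    · intro h; exact absurd (Finset.mem_range.2 (by omega)) h
    · intro i _ hi; simp [hi]
    · intro h; exact absurd (Finset.mem_range.2 (by omega)) h
  rw [point 0 1 (by omega) (by omega), point 1 1 (by omega) (by omega),
    point 1 0 (by omega) (by omega)]
  have s1 : ∑ i ∈ Finset.range (N + 1), ∑ j ∈ Finset.range (N + 1),
      (if i < N ∧ j < N ∧ ¬(i = 0 ∧ j = 0) then W1 β γ l N i j * φ i j else 0) =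
      ∑ i ∈ Finset.range N, ∑ j ∈ Finset.range N,
        if ¬(i = 0 ∧ j = 0) then W1 β γ l N i j * φ i j else 0 := by
    rw [sum_range_succ_of_last (by simp)]
    refine Finset.sum_congr rfl fun i hi => ?_
    rw [sum_range_succ_of_last (by simp)]
    refine Finset.sum_congr rfl fun j hj => ?_
    rw [Finset.mem_range] at hi hj
    simp only [hi, hj, true_and]
  have s2 : ∑ i ∈ Finset.range (N + 1), ∑ j ∈ Finset.range (N + 1),
      (if 1 ≤ i ∧ j < N ∧ ¬(i = 1 ∧ j = 0) then W2 β γ l N i j * φ i j else 0) =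
      ∑ i ∈ Finset.range N, ∑ j ∈ Finset.range N,
        if ¬(i = 0 ∧ j = 0) then W2 β γ l N (i + 1) j * φ (i + 1) j else 0 := by
    rw [sum_range_succ_of_first (by simp)]
    refine Finset.sum_congr rfl fun i hi => ?_
    rw [sum_range_succ_of_last (by simp)]
    refine Finset.sum_congr rfl fun j hj => ?_
    rw [Finset.mem_range] at hi hj
    simp [hj]
  have s3 : ∑ i ∈ Finset.range (N + 1), ∑ j ∈ Finset.range (N + 1),
      (if i < N ∧ 1 ≤ j ∧ ¬(i = 0 ∧ j = 1) then W3 β γ l N i j * φ i j else 0) =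
      ∑ i ∈ Finset.range N, ∑ j ∈ Finset.range N,
        if ¬(i = 0 ∧ j = 0) then W3 β γ l N i (j + 1) * φ i (j + 1) else 0 := by
    rw [sum_range_succ_of_last (by simp)]
    refine Finset.sum_congr rfl fun i hi => ?_
    rw [sum_range_succ_of_first (by simp)]
    refine Finset.sum_congr rfl fun j hj => ?_
    rw [Finset.mem_range] at hi hj
    simp [hi]
  have s4 : ∑ i ∈ Finset.range (N + 1), ∑ j ∈ Finset.range (N + 1),
      (if 1 ≤ i ∧ 1 ≤ j ∧ ¬(i = 1 ∧ j = 1) then W4 β γ l N i j * φ i j else 0) =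
      ∑ i ∈ Finset.range N, ∑ j ∈ Finset.range N,
        if ¬(i = 0 ∧ j = 0) then W4 β γ l N (i + 1) (j + 1) * φ (i + 1) (j + 1) else 0 := by
    rw [sum_range_succ_of_first (by simp)]
    refine Finset.sum_congr rfl fun i hi => ?_
    rw [sum_range_succ_of_first (by simp)]
    exact Finset.sum_congr rfl fun j hj => by simp
  have s5 : ∀ i j, (if ¬(i = 0 ∧ j = 0) then
        W1 β γ l N i j * φ i j + W2 β γ l N (i + 1) j * φ (i + 1) j +
          W3 β γ l N i (j + 1) * φ i (j + 1) +
          W4 β γ l N (i + 1) (j + 1) * φ (i + 1) (j + 1) else 0) =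
      (if ¬(i = 0 ∧ j = 0) then W1 β γ l N i j * φ i j else 0) +
      (if ¬(i = 0 ∧ j = 0) then W2 β γ l N (i + 1) j * φ (i + 1) j else 0) +
      (if ¬(i = 0 ∧ j = 0) then W3 β γ l N i (j + 1) * φ i (j + 1) else 0) +
      (if ¬(i = 0 ∧ j = 0) then W4 β γ l N (i + 1) (j + 1) * φ (i + 1) (j + 1) else 0) := by
    intro i j
    split_ifs <;> simp
  rw [s1, s2, s3, s4]
  simp only [s5, Finset.sum_add_distrib]
  ring

/-! ### Integrals of powers of the sup norm of the plane -/

/-- The factor in front of a radial integral in the sup norm of the plane. -/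
def polarConst : ℝ := 2 * volume.real (Metric.ball (0 : ℝ × ℝ) 1)

lemma polarConst_nonneg : 0 ≤ polarConst := mul_nonneg zero_le_two measureReal_nonneg

/-- Polar integration is valid for any norm. The sup norm fits the grid, since the squares [0,h]²
and [0,L]² are cut out by its balls; dimension two gives the Jacobian y. -/
lemma integrableOn_norm_preimage_iff {f : ℝ → ℝ} {T : Set ℝ} (hT : MeasurableSet T)
    (hT0 : T ⊆ Ioi 0) :
    IntegrableOn (fun z : ℝ × ℝ => f ‖z‖) {z | ‖z‖ ∈ T} ↔ IntegrableOn (fun y => y * f y) T := by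
  have hm : MeasurableSet {z : ℝ × ℝ | ‖z‖ ∈ T} := measurable_norm hT
  have h := integrable_fun_norm_addHaar (E := ℝ × ℝ) volume (f := T.indicator f)
  rw [← integrable_indicator_iff hm]
  have e1 : (fun z : ℝ × ℝ => T.indicator f ‖z‖) =
      {z : ℝ × ℝ | ‖z‖ ∈ T}.indicator fun z => f ‖z‖ := by
    funext z
    by_cases hz : ‖z‖ ∈ T <;> simp [indicator, hz]
  rw [← e1, h]
  have e2 : (fun y : ℝ => y ^ (Module.finrank ℝ (ℝ × ℝ) - 1) • T.indicator f y) =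
      T.indicator fun y => y * f y := by
    funext y
    by_cases hy : y ∈ T <;> simp [indicator, hy]
  rw [e2, IntegrableOn, integrable_indicator_iff hT, IntegrableOn, Measure.restrict_restrict hT,
    inter_eq_left.2 hT0]
  exact Iff.rfl

lemma setIntegral_norm_preimage (f : ℝ → ℝ) {T : Set ℝ} (hT : MeasurableSet T)
    (hT0 : T ⊆ Ioi 0) :
    ∫ z in {z : ℝ × ℝ | ‖z‖ ∈ T}, f ‖z‖ = polarConst * ∫ y in T, y * f y := by
  have hm : MeasurableSet {z : ℝ × ℝ | ‖z‖ ∈ T} := measurable_norm hT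
  have h := integral_fun_norm_addHaar (E := ℝ × ℝ) volume (T.indicator f)
  rw [← integral_indicator hm]
  have e1 : (fun z : ℝ × ℝ => T.indicator f ‖z‖) =
      {z : ℝ × ℝ | ‖z‖ ∈ T}.indicator fun z => f ‖z‖ := by
    funext z
    by_cases hz : ‖z‖ ∈ T <;> simp [indicator, hz]
  rw [← e1, h]
  have e2 : (fun y : ℝ => y ^ (Module.finrank ℝ (ℝ × ℝ) - 1) • T.indicator f y) =
      T.indicator fun y => y * f y := by
    funext y
    by_cases hy : y ∈ T <;> simp [indicator, hy]
  rw [e2, setIntegral_indicator hT, inter_eq_right.2 hT0]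
  simp [polarConst, mul_assoc]

lemma mul_rpow_eqOn {a : ℝ} {T : Set ℝ} (hT0 : T ⊆ Ioi 0) :
    EqOn (fun y : ℝ => y * y ^ a) (fun y => y ^ (a + 1)) T := fun y hy => by
  have : y ≠ 0 := (hT0 hy).ne'
  simp only
  rw [rpow_add_one this, mul_comm]

lemma integrableOn_norm_rpow_far {a R : ℝ} (ha : a < -2) (hR : 0 < R) :
    IntegrableOn (fun z : ℝ × ℝ => ‖z‖ ^ a) {z | R < ‖z‖} := by
  have hT0 : Ioi R ⊆ Ioi 0 := Ioi_subset_Ioi hR.le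
  refine (integrableOn_norm_preimage_iff (f := fun y => y ^ a) measurableSet_Ioi hT0).2 ?_
  rw [integrableOn_congr_fun (mul_rpow_eqOn hT0) measurableSet_Ioi]
  exact integrableOn_Ioi_rpow_of_lt (by linarith) hR

lemma setIntegral_norm_rpow_far {a R : ℝ} (ha : a < -2) (hR : 0 < R) :
    ∫ z in {z : ℝ × ℝ | R < ‖z‖}, ‖z‖ ^ a = polarConst / (-(a + 2)) * R ^ (a + 2) := by
  have hT0 : Ioi R ⊆ Ioi 0 := Ioi_subset_Ioi hR.le
  refine (setIntegral_norm_preimage (fun y => y ^ a) measurableSet_Ioi hT0).trans ?_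
  rw [setIntegral_congr_fun measurableSet_Ioi (mul_rpow_eqOn hT0),
    integral_Ioi_rpow_of_lt (by linarith) hR, show a + 1 + 1 = a + 2 by ring, neg_div, div_neg]
  ring

lemma ae_ne_zero_plane (s : Set (ℝ × ℝ)) :
    s =ᵐ[volume] (s \ {0} : Set (ℝ × ℝ)) :=
  (sdiff_null_ae_eq_self (measure_singleton (0 : ℝ × ℝ))).symm

lemma near_diff_zero (R : ℝ) :
    ({z : ℝ × ℝ | ‖z‖ ≤ R} \ {0} : Set (ℝ × ℝ)) = {z | ‖z‖ ∈ Ioc 0 R} := by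
  ext z
  simp [and_comm]

lemma integrableOn_norm_rpow_near {a R : ℝ} (ha : -2 < a) (hR : 0 < R) :
    IntegrableOn (fun z : ℝ × ℝ => ‖z‖ ^ a) {z | ‖z‖ ≤ R} := by
  have hT0 : Ioc 0 R ⊆ Ioi 0 := Ioc_subset_Ioi_self
  rw [integrableOn_congr_set_ae (ae_ne_zero_plane _), near_diff_zero]
  refine (integrableOn_norm_preimage_iff (f := fun y => y ^ a) measurableSet_Ioc hT0).2 ?_
  rw [integrableOn_congr_fun (mul_rpow_eqOn hT0) measurableSet_Ioc]
  exact (intervalIntegrable_iff_integrableOn_Ioc_of_le hR.le).1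
    (intervalIntegral.intervalIntegrable_rpow' (by linarith))

lemma setIntegral_norm_rpow_near {a R : ℝ} (ha : -2 < a) (hR : 0 < R) :
    ∫ z in {z : ℝ × ℝ | ‖z‖ ≤ R}, ‖z‖ ^ a = polarConst / (a + 2) * R ^ (a + 2) := by
  have hT0 : Ioc 0 R ⊆ Ioi 0 := Ioc_subset_Ioi_self
  rw [setIntegral_congr_set (ae_ne_zero_plane _), near_diff_zero]
  refine (setIntegral_norm_preimage (fun y => y ^ a) measurableSet_Ioc hT0).trans ?_
  rw [setIntegral_congr_fun measurableSet_Ioc (mul_rpow_eqOn hT0),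
    ← intervalIntegral.integral_of_le hR.le, integral_rpow (Or.inl (by linarith)),
    show a + 1 + 1 = a + 2 by ring, zero_rpow (by linarith)]
  ring

/-! ### Comparison of the norms and kernels -/

lemma norm_sq_le_sq2 (z : ℝ × ℝ) : ‖z‖ ^ 2 ≤ sq2 z := by
  rw [Prod.norm_def, sq2, Real.norm_eq_abs, Real.norm_eq_abs]
  rcases max_choice |z.1| |z.2| with h | h <;> rw [h, sq_abs] <;> nlinarith [sq_nonneg z.1, sq_nonneg z.2]

lemma sq2_nonneg (z : ℝ × ℝ) : 0 ≤ sq2 z := add_nonneg (sq_nonneg _) (sq_nonneg _)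

lemma sq2_pos {z : ℝ × ℝ} (hz : 0 < ‖z‖) : 0 < sq2 z :=
  (pow_pos hz 2).trans_le (norm_sq_le_sq2 z)

lemma continuous_sq2 : Continuous sq2 := by unfold sq2; fun_prop

lemma continuousOn_sq2_rpow (a : ℝ) : ContinuousOn (fun z => sq2 z ^ a) {z | 0 < sq2 z} :=
  continuous_sq2.continuousOn.rpow_const fun _ hz => Or.inl (ne_of_gt hz)

lemma measurable_sq2_rpow (a : ℝ) : Measurable fun z => sq2 z ^ a :=
  continuous_sq2.measurable.pow_const a

lemma sq2_rpow_le {z : ℝ × ℝ} (hz : 0 < ‖z‖) {a : ℝ} (ha : a ≤ 0) :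
    sq2 z ^ (a / 2) ≤ ‖z‖ ^ a := by
  calc sq2 z ^ (a / 2) ≤ (‖z‖ ^ 2) ^ (a / 2) :=
        rpow_le_rpow_of_nonpos (pow_pos hz 2) (norm_sq_le_sq2 z) (by linarith)
    _ = ‖z‖ ^ a := by
        rw [← rpow_natCast, ← rpow_mul hz.le]
        congr 1
        push_cast
        ring

lemma eucl_eq (z : ℝ × ℝ) : eucl z = √(sq2 z) := rfl

lemma eucl_rpow (z : ℝ × ℝ) (a : ℝ) : eucl z ^ a = sq2 z ^ (a / 2) := by
  rw [eucl_eq, sqrt_eq_rpow, ← rpow_mul (sq2_nonneg z)]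
  congr 1
  ring

lemma inv_exp_mul_eucl_rpow (lam a : ℝ) (z : ℝ × ℝ) :
    (exp (lam * eucl z) * eucl z ^ a)⁻¹ = radial lam (-(a / 2)) (sq2 z) := by
  rw [radial, eucl_rpow, mul_inv, exp_neg, rpow_neg (sq2_nonneg z), eucl_eq]

lemma temperedKernel_eq (β lam : ℝ) (z : ℝ × ℝ) :
    temperedKernel β lam z = radial lam (-((2 + β) / 2)) (sq2 z) := by
  rw [temperedKernel, one_div, inv_exp_mul_eucl_rpow]

lemma temperedKernel_nonneg (β lam : ℝ) (z : ℝ × ℝ) : 0 ≤ temperedKernel β lam z := by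
  rw [temperedKernel_eq]
  exact radial_nonneg _ _ (sq2_nonneg z)

lemma temperedKernel_pos (β lam : ℝ) {z : ℝ × ℝ} (hz : 0 < ‖z‖) : 0 < temperedKernel β lam z := by
  rw [temperedKernel_eq]
  exact mul_pos (exp_pos _) (rpow_pos_of_pos (sq2_pos hz) _)

lemma temperedKernel_le {β lam : ℝ} (hlam : 0 ≤ lam) (z : ℝ × ℝ) :
    temperedKernel β lam z ≤ sq2 z ^ (-((2 + β) / 2)) := by
  rw [temperedKernel_eq]
  exact radial_le hlam (sq2_nonneg z)

lemma measurable_temperedKernel (β lam : ℝ) : Measurable (temperedKernel β lam) := by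
  have : temperedKernel β lam = fun z => radial lam (-((2 + β) / 2)) (sq2 z) :=
    funext (temperedKernel_eq β lam)
  rw [this]
  unfold radial
  exact ((continuous_sq2.measurable.sqrt.const_mul lam).neg.exp).mul (measurable_sq2_rpow _)

lemma continuousOn_temperedKernel (β lam : ℝ) :
    ContinuousOn (temperedKernel β lam) {z | 0 < sq2 z} := by
  have : temperedKernel β lam = fun z => radial lam (-((2 + β) / 2)) (sq2 z) :=
    funext (temperedKernel_eq β lam)
  rw [this]
  exact ContinuousOn.mul (continuous_sq2.sqrt.const_mul lam).neg.rexp.continuousOn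
    (continuousOn_sq2_rpow _)

lemma measurableSet_norm_gt (R : ℝ) : MeasurableSet {z : ℝ × ℝ | R < ‖z‖} :=
  measurableSet_lt measurable_const measurable_norm

lemma integrableOn_sq2_rpow_far {β R : ℝ} (hβ : 0 < β) (hR : 0 < R) :
    IntegrableOn (fun z => sq2 z ^ (-((2 + β) / 2))) {z | R < ‖z‖} := by
  refine Integrable.mono' (integrableOn_norm_rpow_far (a := -(2 + β)) (by linarith) hR)
    (measurable_sq2_rpow _).aestronglyMeasurable ?_
  refine (ae_restrict_iff' (measurableSet_norm_gt R)).2 (ae_of_all _ fun z hz => ?_)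
  rw [Real.norm_eq_abs, abs_of_nonneg (rpow_nonneg (sq2_nonneg z) _), ← neg_div]
  exact sq2_rpow_le (hR.trans hz) (by linarith)

lemma setIntegral_sq2_rpow_far_le {β R : ℝ} (hβ : 0 < β) (hR : 0 < R) :
    ∫ z in {z : ℝ × ℝ | R < ‖z‖}, sq2 z ^ (-((2 + β) / 2)) ≤ polarConst / β * R ^ (-β) := by
  have h := setIntegral_norm_rpow_far (a := -(2 + β)) (by linarith) hR
  rw [show -(2 + β) + 2 = -β by ring, neg_neg] at h
  rw [← h]
  refine setIntegral_mono_on (integrableOn_sq2_rpow_far hβ hR)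
    (integrableOn_norm_rpow_far (by linarith) hR) (measurableSet_norm_gt R) fun z hz => ?_
  rw [← neg_div]
  exact sq2_rpow_le (hR.trans hz) (by linarith)

lemma integrableOn_temperedKernel {β lam R : ℝ} (hβ : 0 < β) (hlam : 0 ≤ lam) (hR : 0 < R) :
    IntegrableOn (temperedKernel β lam) {z | R < ‖z‖} := by
  refine Integrable.mono' (integrableOn_sq2_rpow_far hβ hR)
    (measurable_temperedKernel β lam).aestronglyMeasurable (ae_of_all _ fun z => ?_)
  rw [Real.norm_eq_abs, abs_of_nonneg (temperedKernel_nonneg β lam z)]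
  exact temperedKernel_le hlam z

/-- The open first quadrant. -/
def quadrant : Set (ℝ × ℝ) := Ioi 0 ×ˢ Ioi 0

lemma measurableSet_quadrant : MeasurableSet quadrant := measurableSet_Ioi.prod measurableSet_Ioi

lemma norm_of_mem_quadrant {z : ℝ × ℝ} (hz : z ∈ quadrant) : ‖z‖ = max z.1 z.2 := by
  rw [Prod.norm_def, Real.norm_eq_abs, Real.norm_eq_abs, abs_of_pos hz.1, abs_of_pos hz.2]

lemma lt_norm_of_fst {z : ℝ × ℝ} {R : ℝ} (h : R < z.1) : R < ‖z‖ :=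
  h.trans_le ((le_abs_self _).trans (le_max_left _ _))

lemma lt_norm_of_snd {z : ℝ × ℝ} {R : ℝ} (h : R < z.2) : R < ‖z‖ :=
  h.trans_le ((le_abs_self _).trans (le_max_right _ _))

/-- The three rectangles make up this set except for pieces of the axes, which are null. -/
lemma Ginf_eq {β lam l : ℝ} (hβ : 0 < β) (hlam : 0 ≤ lam) (hl : 0 < l) :
    Ginf β lam l = ∫ z in quadrant ∩ {z | 2 * l < ‖z‖}, temperedKernel β lam z := by
  have hL : 0 < 2 * l := by positivity
  have hint := integrableOn_temperedKernel hβ hlam hL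
  have e1 : (Icc 0 (2 * l) ×ˢ Ioi (2 * l) : Set (ℝ × ℝ)) =ᵐ[volume]
      (Ioc 0 (2 * l) ×ˢ Ioi (2 * l) : Set (ℝ × ℝ)) :=
    Measure.set_prod_ae_eq Ioc_ae_eq_Icc.symm (ae_eq_refl _)
  have e2 : (Ioi (2 * l) ×ˢ Icc 0 (2 * l) : Set (ℝ × ℝ)) =ᵐ[volume]
      (Ioi (2 * l) ×ˢ Ioc 0 (2 * l) : Set (ℝ × ℝ)) :=
    Measure.set_prod_ae_eq (ae_eq_refl _) Ioc_ae_eq_Icc.symm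
  have hs : quadrant ∩ {z | 2 * l < ‖z‖} = (Ioc 0 (2 * l) ×ˢ Ioi (2 * l) ∪
      Ioi (2 * l) ×ˢ Ioc 0 (2 * l)) ∪ Ioi (2 * l) ×ˢ Ioi (2 * l) := by
    ext z
    constructor
    · rintro ⟨hq, hz⟩
      rw [mem_ofPred_eq, norm_of_mem_quadrant hq, lt_max_iff] at hz
      simp only [quadrant, mem_union, mem_prod, mem_Ioi, mem_Ioc] at hq ⊢
      rcases le_or_gt z.1 (2 * l) with h1 | h1 <;> rcases le_or_gt z.2 (2 * l) with h2 | h2 <;>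
        grind
    · intro h
      simp only [mem_union, mem_prod, mem_Ioi, mem_Ioc] at h
      have hq : z ∈ quadrant := by
        simp only [quadrant, mem_prod, mem_Ioi]
        rcases h with (h | h) | h <;> constructor <;> linarith [h.1, h.2]
      refine ⟨hq, ?_⟩
      rcases h with (h | h) | h
      exacts [lt_norm_of_snd h.2, lt_norm_of_fst h.1, lt_norm_of_snd h.2]
  rw [Ginf, setIntegral_congr_set e1, setIntegral_congr_set e2, hs,
    setIntegral_union _ (measurableSet_Ioi.prod measurableSet_Ioi),
    setIntegral_union _ (measurableSet_Ioi.prod measurableSet_Ioc)]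
  · exact hint.mono_set fun z hz => lt_norm_of_snd hz.2
  · exact hint.mono_set fun z hz => lt_norm_of_fst hz.1
  · exact Set.disjoint_left.2 fun z h h' => absurd h.1.2 (not_le.2 h'.1)
  · refine hint.mono_set ?_
    rintro z (hz | hz)
    exacts [lt_norm_of_snd hz.2, lt_norm_of_fst hz.1]
  · exact hint.mono_set fun z hz => lt_norm_of_snd hz.2
  · refine Set.disjoint_left.2 ?_
    rintro z (h | h) h'
    exacts [absurd h.1.2 (not_le.2 h'.1), absurd h.2.2 (not_le.2 h'.2)]

/-- The coercivity constant of the scheme: the kernel is positive on (2l, ∞)². -/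
lemma Ginf_pos {β lam l : ℝ} (hβ : 0 < β) (hlam : 0 ≤ lam) (hl : 0 < l) : 0 < Ginf β lam l := by
  have hL : 0 < 2 * l := by positivity
  rw [Ginf_eq hβ hlam hl, setIntegral_pos_iff_support_of_nonneg_ae
    (ae_of_all _ (temperedKernel_nonneg β lam))
    ((integrableOn_temperedKernel hβ hlam hL).mono_set inter_subset_right)]
  have hsub : (Ioi (2 * l) ×ˢ Ioi (2 * l) : Set (ℝ × ℝ)) ⊆
      Function.support (temperedKernel β lam) ∩ (quadrant ∩ {z | 2 * l < ‖z‖}) := fun z hz =>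
    ⟨(temperedKernel_pos β lam (hL.trans (lt_norm_of_fst hz.1))).ne',
      ⟨hL.trans hz.1, hL.trans hz.2⟩, lt_norm_of_fst hz.1⟩
  refine lt_of_lt_of_le ?_ (measure_mono hsub)
  rw [Measure.volume_eq_prod, Measure.prod_prod]
  simp

/-- In the tempered case Γ(-β) must not be at a pole, where it takes the default value 0; the only
pole for β in (0,2) is at β = 1. -/
lemma normConst_pos {β lam : ℝ} (hβ0 : 0 < β) (hβ2 : β < 2) (hβlam : lam ≠ 0 → β ≠ 1) :
    0 < normConst 2 β lam := by
  unfold normConst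
  split_ifs with h
  · have h1 : 0 < Real.Gamma (((2 : ℕ) + β) / 2) := Gamma_pos_of_pos (by push_cast; linarith)
    have h2 : 0 < Real.Gamma (1 - β / 2) := Gamma_pos_of_pos (by linarith)
    positivity
  · have h1 : 0 < Real.Gamma (((2 : ℕ) : ℝ) / 2) := Gamma_pos_of_pos (by norm_num)
    have h2 : Real.Gamma (-β) ≠ 0 := by
      refine Real.Gamma_ne_zero fun m hm => ?_
      have hm' : β = m := by linarith
      have : m = 1 := by
        have h3 : (0 : ℝ) < m := by linarith
        have h4 : (m : ℝ) < 2 := by linarith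
        have h3' : 0 < m := by exact_mod_cast h3
        have h4' : m < 2 := by exact_mod_cast h4
        omega
      exact hβlam h (by rw [hm', this]; simp)
    have h3 := abs_pos.2 h2
    positivity

/-! ### Symmetrization -/

lemma measurePreserving_neg_fst :
    MeasurePreserving (fun z : ℝ × ℝ => (-z.1, z.2)) volume volume := by
  have := (Measure.measurePreserving_neg (volume : Measure ℝ)).prod
    (MeasurePreserving.id (volume : Measure ℝ))
  exact this

lemma measurableEmbedding_neg_fst : MeasurableEmbedding fun z : ℝ × ℝ => (-z.1, z.2) :=
  ((MeasurableEquiv.neg ℝ).prodCongr (MeasurableEquiv.refl ℝ)).measurableEmbedding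

lemma measurePreserving_neg_snd :
    MeasurePreserving (fun z : ℝ × ℝ => (z.1, -z.2)) volume volume := by
  have := (MeasurePreserving.id (volume : Measure ℝ)).prod
    (Measure.measurePreserving_neg (volume : Measure ℝ))
  exact this

lemma measurableEmbedding_neg_snd : MeasurableEmbedding fun z : ℝ × ℝ => (z.1, -z.2) :=
  ((MeasurableEquiv.refl ℝ).prodCongr (MeasurableEquiv.neg ℝ)).measurableEmbedding

lemma integral_eq_half_plane_fst {F : ℝ × ℝ → ℝ} (hF : Integrable F) :
    ∫ z, F z = ∫ z in Ioi 0 ×ˢ univ, (F z + F (-z.1, z.2)) := by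
  have hms : MeasurableSet (Ioi 0 ×ˢ univ : Set (ℝ × ℝ)) := measurableSet_Ioi.prod .univ
  have hi : Integrable fun z : ℝ × ℝ => F (-z.1, z.2) :=
    measurePreserving_neg_fst.integrable_comp_of_integrable hF
  rw [integral_add hF.integrableOn hi.integrableOn, ← integral_add_compl hms hF]
  congr 1
  have e : ((Ioi 0 ×ˢ univ : Set (ℝ × ℝ))ᶜ : Set (ℝ × ℝ)) =ᵐ[volume]
      (Iio 0 ×ˢ univ : Set (ℝ × ℝ)) := by
    have : ((Ioi 0 ×ˢ univ : Set (ℝ × ℝ))ᶜ : Set (ℝ × ℝ)) = Iic 0 ×ˢ univ := by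
      ext z; simp
    rw [this]
    exact Measure.set_prod_ae_eq Iio_ae_eq_Iic.symm (ae_eq_refl _)
  rw [setIntegral_congr_set e, ← measurePreserving_neg_fst.setIntegral_preimage_emb
    measurableEmbedding_neg_fst F]
  congr 2
  ext z; simp

lemma integral_eq_half_plane_snd {F : ℝ × ℝ → ℝ} (hF : Integrable F) :
    ∫ z, F z = ∫ z in univ ×ˢ Ioi 0, (F z + F (z.1, -z.2)) := by
  have hms : MeasurableSet (univ ×ˢ Ioi 0 : Set (ℝ × ℝ)) := .prod .univ measurableSet_Ioi
  have hi : Integrable fun z : ℝ × ℝ => F (z.1, -z.2) :=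
    measurePreserving_neg_snd.integrable_comp_of_integrable hF
  rw [integral_add hF.integrableOn hi.integrableOn, ← integral_add_compl hms hF]
  congr 1
  have e : ((univ ×ˢ Ioi 0 : Set (ℝ × ℝ))ᶜ : Set (ℝ × ℝ)) =ᵐ[volume]
      (univ ×ˢ Iio 0 : Set (ℝ × ℝ)) := by
    have : ((univ ×ˢ Ioi 0 : Set (ℝ × ℝ))ᶜ : Set (ℝ × ℝ)) = univ ×ˢ Iic 0 := by
      ext z; simp
    rw [this]
    exact Measure.set_prod_ae_eq (ae_eq_refl _) Iio_ae_eq_Iic.symm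
  rw [setIntegral_congr_set e, ← measurePreserving_neg_snd.setIntegral_preimage_emb
    measurableEmbedding_neg_snd F]
  congr 2
  ext z; simp

/-- The sum of the values of a function at the four points `(±z₁, ±z₂)`. -/
def foldSum (F : ℝ × ℝ → ℝ) (z : ℝ × ℝ) : ℝ :=
  F z + F (-z.1, z.2) + (F (z.1, -z.2) + F (-z.1, -z.2))

lemma integral_eq_quadrant {F : ℝ × ℝ → ℝ} (hF : Integrable F) :
    ∫ z, F z = ∫ z in quadrant, foldSum F z := by
  have hms : MeasurableSet (Ioi 0 ×ˢ univ : Set (ℝ × ℝ)) := measurableSet_Ioi.prod .univ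
  have hi : Integrable fun z : ℝ × ℝ => F (-z.1, z.2) :=
    measurePreserving_neg_fst.integrable_comp_of_integrable hF
  have hi' : Integrable fun z : ℝ × ℝ => F z + F (-z.1, z.2) := hF.add hi
  -- The half-plane integral is rewritten as one over the whole plane so that the second reflection
  -- applies.
  rw [integral_eq_half_plane_fst hF, ← integral_indicator hms,
    integral_eq_half_plane_snd (hi'.indicator hms)]
  have : quadrant = (univ ×ˢ Ioi 0) ∩ (Ioi 0 ×ˢ univ) := by ext z; simp [quadrant, and_comm]
  rw [this, ← setIntegral_indicator hms]
  refine integral_congr_ae (ae_of_all _ fun z => ?_)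
  by_cases hz : 0 < z.1 <;> simp [indicator, hz, foldSum]

lemma integrable_foldSum {F : ℝ × ℝ → ℝ} (hF : Integrable F) : Integrable (foldSum F) := by
  have h1 : Integrable fun z : ℝ × ℝ => F (-z.1, z.2) :=
    measurePreserving_neg_fst.integrable_comp_of_integrable hF
  have h2 : Integrable fun z : ℝ × ℝ => F (z.1, -z.2) :=
    measurePreserving_neg_snd.integrable_comp_of_integrable hF
  have h3 : Integrable fun z : ℝ × ℝ => F (-z.1, -z.2) :=
    measurePreserving_neg_snd.integrable_comp_of_integrable h1
  exact (hF.add h1).add (h2.add h3)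

/-! ### Nodes and cells -/

lemma mesh_pos {l : ℝ} {N : ℕ} (hl : 0 < l) (hN : 0 < N) : 0 < mesh l N := by
  unfold mesh; positivity

lemma node_zero (l : ℝ) (N : ℕ) : node l N 0 = 0 := by simp [node]

lemma node_one (l : ℝ) (N : ℕ) : node l N 1 = mesh l N := by simp [node]

lemma node_last (l : ℝ) {N : ℕ} (hN : 0 < N) : node l N N = 2 * l := by
  unfold node mesh; field_simp

lemma node_succ (l : ℝ) (N i : ℕ) : node l N (i + 1) = node l N i + mesh l N := by
  simp only [node]; push_cast; ring

lemma node_nonneg {l : ℝ} (hl : 0 < l) (N i : ℕ) : 0 ≤ node l N i := by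
  unfold node mesh; positivity

lemma node_monotone {l : ℝ} (hl : 0 < l) (N : ℕ) : Monotone (node l N) :=
  monotone_nat_of_le_succ fun i => by
    have : 0 ≤ mesh l N := by unfold mesh; positivity
    rw [node_succ]; linarith

lemma mesh_le_node {l : ℝ} (hl : 0 < l) (N : ℕ) {i : ℕ} (hi : 1 ≤ i) : mesh l N ≤ node l N i :=
  node_one l N ▸ node_monotone hl N hi

lemma mesh_sq_le_sq2_node {l : ℝ} (hl : 0 < l) (N : ℕ) {i j : ℕ} (h : ¬(i = 0 ∧ j = 0)) :
    mesh l N ^ 2 ≤ sq2 (node l N i, node l N j) := by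
  have h0 : 0 ≤ mesh l N := by unfold mesh; positivity
  rw [sq2]
  rcases Nat.eq_zero_or_pos i with hi | hi
  · have : mesh l N ^ 2 ≤ node l N j ^ 2 :=
      pow_le_pow_left₀ h0 (mesh_le_node hl N (by omega)) 2
    nlinarith [sq_nonneg (node l N i)]
  · have : mesh l N ^ 2 ≤ node l N i ^ 2 := pow_le_pow_left₀ h0 (mesh_le_node hl N hi) 2
    nlinarith [sq_nonneg (node l N j)]

lemma cell_eq (l : ℝ) (N i j : ℕ) : cell l N i j =
    Icc (node l N i) (node l N i + mesh l N) ×ˢ Icc (node l N j) (node l N j + mesh l N) := by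
  rw [cell, node_succ, node_succ]

lemma isCompact_cell (l : ℝ) (N i j : ℕ) : IsCompact (cell l N i j) :=
  isCompact_Icc.prod isCompact_Icc

lemma measurableSet_cell (l : ℝ) (N i j : ℕ) : MeasurableSet (cell l N i j) :=
  measurableSet_Icc.prod measurableSet_Icc

lemma sq2_pos_of_mem_cell {l : ℝ} (hl : 0 < l) {N : ℕ} (hN : 0 < N) {i j : ℕ}
    (h : ¬(i = 0 ∧ j = 0)) {z : ℝ × ℝ} (hz : z ∈ cell l N i j) : 0 < sq2 z := by
  have h1 := mesh_sq_le_sq2_node hl N h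
  have h2 := pow_pos (mesh_pos hl hN) 2
  have h3 := node_nonneg hl N i
  have h4 := node_nonneg hl N j
  have h5 : sq2 (node l N i, node l N j) ≤ sq2 z := by
    have := hz.1.1
    have := hz.2.1
    simp only [sq2]
    gcongr
  linarith

/-- The part of the first quadrant where `h < max ≤ L`. -/
def frame (l : ℝ) (N : ℕ) : Set (ℝ × ℝ) := quadrant ∩ {z | mesh l N < ‖z‖ ∧ ‖z‖ ≤ 2 * l}

lemma frame_subset (l : ℝ) (N : ℕ) : frame l N ⊆ {z | mesh l N < ‖z‖} := fun _ hz => hz.2.1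

/-- The half open version of `cell`. -/
def halfCell (l : ℝ) (N : ℕ) (p : ℕ × ℕ) : Set (ℝ × ℝ) :=
  Ioc (node l N p.1) (node l N (p.1 + 1)) ×ˢ Ioc (node l N p.2) (node l N (p.2 + 1))

lemma exists_mem_Ioc_node {l : ℝ} (hl : 0 < l) {N : ℕ} (hN : 0 < N) {t : ℝ}
    (ht : t ∈ Ioc 0 (2 * l)) : ∃ i < N, t ∈ Ioc (node l N i) (node l N (i + 1)) := by
  have h := (node_monotone hl N).biUnion_Ico_Ioc_map_succ 0 N
  rw [node_zero, node_last l hN] at h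
  rw [← h] at ht
  simp only [mem_iUnion, mem_Ico] at ht
  obtain ⟨i, hi, hti⟩ := ht
  exact ⟨i, hi.2, hti⟩

/-- In the quadrant the sup norm is the larger coordinate, so ‖z‖ > h removes exactly the half-open
cell (0,0), and ‖z‖ ≤ 2l keeps the cells with both indices below N. -/
lemma frame_eq {l : ℝ} (hl : 0 < l) {N : ℕ} (hN : 0 < N) :
    frame l N = ⋃ p ∈ (Finset.range N ×ˢ Finset.range N).erase (0, 0), halfCell l N p := by
  ext z
  simp only [mem_iUnion, Finset.mem_erase, Finset.mem_product, Finset.mem_range, ne_eq]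
  constructor
  · rintro ⟨hq, h1, h2⟩
    rw [norm_of_mem_quadrant hq] at h1 h2
    obtain ⟨i, hi, hzi⟩ := exists_mem_Ioc_node hl hN ⟨hq.1, (le_max_left _ _).trans h2⟩
    obtain ⟨j, hj, hzj⟩ := exists_mem_Ioc_node hl hN ⟨hq.2, (le_max_right _ _).trans h2⟩
    refine ⟨(i, j), ⟨fun h => ?_, hi, hj⟩, hzi, hzj⟩
    obtain ⟨rfl, rfl⟩ := Prod.mk.inj h
    rw [zero_add, node_one] at hzi hzj
    exact absurd h1 (not_lt.2 (max_le hzi.2 hzj.2))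
  · rintro ⟨⟨i, j⟩, ⟨h0, hi, hj⟩, hz⟩
    obtain ⟨⟨h1, h2⟩, h3, h4⟩ := hz
    simp only at h0 hi hj h1 h2 h3 h4
    have hq : z ∈ quadrant :=
      ⟨(node_nonneg hl N i).trans_lt h1, (node_nonneg hl N j).trans_lt h3⟩
    refine ⟨hq, ?_, ?_⟩
    · rcases Nat.eq_zero_or_pos i with hi0 | hi0
      · have : 1 ≤ j := by
          rcases Nat.eq_zero_or_pos j with hj0 | hj0
          · exact absurd (Prod.ext hi0 hj0) h0
          · exact hj0
        exact lt_norm_of_snd ((mesh_le_node hl N this).trans_lt h3)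
      · exact lt_norm_of_fst ((mesh_le_node hl N hi0).trans_lt h1)
    · rw [norm_of_mem_quadrant hq, ← node_last l hN]
      exact max_le (h2.trans (node_monotone hl N hi)) (h4.trans (node_monotone hl N hj))

lemma measurableSet_halfCell (l : ℝ) (N : ℕ) (p : ℕ × ℕ) : MeasurableSet (halfCell l N p) :=
  measurableSet_Ioc.prod measurableSet_Ioc

lemma measurableSet_frame (l : ℝ) (N : ℕ) : MeasurableSet (frame l N) :=
  measurableSet_quadrant.inter
    ((measurableSet_norm_gt _).inter (measurableSet_le measurable_norm measurable_const))

/-- Half-open cells are disjoint, and closing them adds only null sets. -/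
lemma setIntegral_frame {l : ℝ} (hl : 0 < l) {N : ℕ} (hN : 0 < N) {F : ℝ × ℝ → ℝ}
    (hF : IntegrableOn F (frame l N)) :
    ∫ z in frame l N, F z = ∑ p ∈ (Finset.range N ×ˢ Finset.range N).erase (0, 0),
      ∫ z in cell l N p.1 p.2, F z := by
  rw [frame_eq hl hN] at hF ⊢
  rw [integral_biUnion_finset _ fun p _ => measurableSet_halfCell l N p]
  · refine Finset.sum_congr rfl fun p _ => setIntegral_congr_set ?_
    exact Measure.set_prod_ae_eq Ioc_ae_eq_Icc Ioc_ae_eq_Icc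
  · intro p _ q _ hpq
    have hd := (node_monotone hl N).pairwise_disjoint_on_Ioc_succ
    rw [Function.onFun, halfCell, halfCell, Set.disjoint_prod]
    by_cases h : p.1 = q.1
    · exact Or.inr (hd fun h' => hpq (Prod.ext h h'))
    · exact Or.inl (hd h)
  · exact fun p hp => hF.mono_set (subset_biUnion_of_mem (u := halfCell l N) hp)

/-! ### Moments -/

lemma weight_eq (β γ : ℝ) (z : ℝ × ℝ) : weight β γ z = sq2 z ^ ((γ - 2 - β) / 2) := rfl

lemma weight_nonneg (β γ : ℝ) (z : ℝ × ℝ) : 0 ≤ weight β γ z := rpow_nonneg (sq2_nonneg z) _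

lemma integrableOn_cell {l : ℝ} (hl : 0 < l) {N : ℕ} (hN : 0 < N) {i j : ℕ}
    (h : ¬(i = 0 ∧ j = 0)) {f : ℝ × ℝ → ℝ} (hf : ContinuousOn f {z | 0 < sq2 z}) :
    IntegrableOn f (cell l N i j) :=
  (hf.mono fun _ hz => sq2_pos_of_mem_cell hl hN h hz).integrableOn_compact (isCompact_cell l N i j)

lemma integrableOn_mul_weight {l : ℝ} (hl : 0 < l) {N : ℕ} (hN : 0 < N) {i j : ℕ}
    (h : ¬(i = 0 ∧ j = 0)) (β γ : ℝ) {g : ℝ × ℝ → ℝ} (hg : Continuous g) :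
    IntegrableOn (fun z => g z * weight β γ z) (cell l N i j) :=
  integrableOn_cell hl hN h (hg.continuousOn.mul (continuousOn_sq2_rpow _))

lemma integral_linear_comb {α : Type*} [MeasurableSpace α] {μ : Measure α} {f₁ f₂ f₃ f₄ : α → ℝ}
    (h₁ : Integrable f₁ μ) (h₂ : Integrable f₂ μ) (h₃ : Integrable f₃ μ) (h₄ : Integrable f₄ μ)
    (c₁ c₂ c₃ c₄ : ℝ) :
    ∫ z, (c₁ * f₁ z + c₂ * f₂ z + c₃ * f₃ z + c₄ * f₄ z) ∂μ =
      c₁ * ∫ z, f₁ z ∂μ + c₂ * ∫ z, f₂ z ∂μ + c₃ * ∫ z, f₃ z ∂μ + c₄ * ∫ z, f₄ z ∂μ := by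
  have i2 : Integrable (fun z => c₁ * f₁ z + c₂ * f₂ z) μ := (h₁.const_mul c₁).add (h₂.const_mul c₂)
  have i3 : Integrable (fun z => c₁ * f₁ z + c₂ * f₂ z + c₃ * f₃ z) μ := i2.add (h₃.const_mul c₃)
  rw [integral_add i3 (h₄.const_mul c₄), integral_add i2 (h₃.const_mul c₃),
    integral_add (h₁.const_mul c₁) (h₂.const_mul c₂)]
  simp only [integral_const_mul]

/-- Off the cell (0,0) the weight is continuous, so the four integrals exist separately and may be
recombined. -/
lemma moment_eq {l : ℝ} (hl : 0 < l) {N : ℕ} (hN : 0 < N) {i j : ℕ}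
    (h : ¬(i = 0 ∧ j = 0)) (β γ a b : ℝ) :
    moment β γ l N i j a b =
      1 / mesh l N ^ 2 * ∫ z in cell l N i j, (z.1 - a) * (z.2 - b) * weight β γ z := by
  have i1 := integrableOn_mul_weight hl hN h β γ (g := fun z => z.1 * z.2) (by fun_prop)
  have i2 := integrableOn_mul_weight hl hN h β γ (g := fun z => z.2) (by fun_prop)
  have i3 := integrableOn_mul_weight hl hN h β γ (g := fun z => z.1) (by fun_prop)
  have i4 : IntegrableOn (weight β γ) (cell l N i j) :=
    integrableOn_cell hl hN h (continuousOn_sq2_rpow _)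
  have e : (fun z : ℝ × ℝ => (z.1 - a) * (z.2 - b) * weight β γ z) = fun z =>
      1 * (z.1 * z.2 * weight β γ z) + -a * (z.2 * weight β γ z) + -b * (z.1 * weight β γ z) +
        a * b * weight β γ z := by
    funext z; ring
  rw [e, integral_linear_comb i1 i2 i3 i4, moment, Gxieta, Geta, Gxi, G]
  ring

lemma moment_nonneg {l : ℝ} (hl : 0 < l) {N : ℕ} (hN : 0 < N) {i j : ℕ}
    (h : ¬(i = 0 ∧ j = 0)) (β γ : ℝ) {a b : ℝ}
    (hab : ∀ z ∈ cell l N i j, 0 ≤ (z.1 - a) * (z.2 - b)) : 0 ≤ moment β γ l N i j a b := by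
  rw [moment_eq hl hN h]
  exact mul_nonneg (by positivity) (setIntegral_nonneg (measurableSet_cell l N i j)
    fun z hz => mul_nonneg (hab z hz) (weight_nonneg β γ z))

lemma neg_moment_nonneg {l : ℝ} (hl : 0 < l) {N : ℕ} (hN : 0 < N) {i j : ℕ}
    (h : ¬(i = 0 ∧ j = 0)) (β γ : ℝ) {a b : ℝ}
    (hab : ∀ z ∈ cell l N i j, (z.1 - a) * (z.2 - b) ≤ 0) : 0 ≤ -moment β γ l N i j a b := by
  rw [moment_eq hl hN h, ← mul_neg]
  refine mul_nonneg (by positivity) (neg_nonneg.2 (setIntegral_nonpos (measurableSet_cell l N i j)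
    fun z hz => mul_nonpos_of_nonpos_of_nonneg (hab z hz) (weight_nonneg β γ z)))

lemma Gzero_nonneg (β γ l : ℝ) (N : ℕ) : 0 ≤ Gzero β γ l N :=
  integral_nonneg (weight_nonneg β γ)

lemma kGamma_nonneg (γ : ℝ) : 0 ≤ kGamma γ := by unfold kGamma; split_ifs <;> norm_num

lemma kGamma_le (γ : ℝ) : kGamma γ ≤ 4 / 3 := by unfold kGamma; split_ifs <;> norm_num

/-- Each contribution integrates a nonnegative nodal basis function against the weight; the minus
signs in `W2` and `W3` make up for the sign of (ξ - a)(η - b) on the cell. -/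
lemma quadCoeff_nonneg {β γ l : ℝ} (hl : 0 < l) {N i j : ℕ} (hN : 2 ≤ N) (hi : i ≤ N) (hj : j ≤ N)
    (h0 : ¬(i = 0 ∧ j = 0)) : 0 ≤ quadCoeff β γ l N i j := by
  have hN0 : 0 < N := by omega
  rw [quadCoeff_eq hN hi hj h0]
  refine add_nonneg (add_nonneg (add_nonneg (add_nonneg ?_ ?_) ?_) ?_) ?_ <;> split_ifs with h <;>
    try exact le_rfl
  · exact mul_nonneg (div_nonneg (kGamma_nonneg γ) (by norm_num)) (Gzero_nonneg β γ l N)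
  · exact moment_nonneg hl hN0 h0 β γ fun z hz =>
      mul_nonneg_of_nonpos_of_nonpos (sub_nonpos.2 hz.1.2) (sub_nonpos.2 hz.2.2)
  · exact neg_moment_nonneg hl hN0 (by omega) β γ fun z hz =>
      mul_nonpos_of_nonneg_of_nonpos (sub_nonneg.2 hz.1.1) (sub_nonpos.2 hz.2.2)
  · exact neg_moment_nonneg hl hN0 (by omega) β γ fun z hz =>
      mul_nonpos_of_nonpos_of_nonneg (sub_nonpos.2 hz.1.2) (sub_nonneg.2 hz.2.1)
  · exact moment_nonneg hl hN0 (by omega) β γ fun z hz =>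
      mul_nonneg (sub_nonneg.2 hz.1.1) (sub_nonneg.2 hz.2.1)

lemma quadCoeffScaled_nonneg {β lam γ l : ℝ} (hl : 0 < l) {N : ℕ} (hN : 2 ≤ N) :
    ∀ p ∈ (Finset.range (N + 1) ×ˢ Finset.range (N + 1)).erase (0, 0),
      0 ≤ quadCoeffScaled β lam γ l N p.1 p.2 := by
  rintro ⟨i, j⟩ hp
  simp only [Finset.mem_erase, Finset.mem_product, Finset.mem_range, ne_eq, Prod.mk.injEq] at hp
  exact div_nonneg (quadCoeff_nonneg hl hN (by omega) (by omega) hp.1)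
    (mul_nonneg (exp_pos _).le (rpow_nonneg (sqrt_nonneg _) _))

lemma quadCoeffScaled_eq (β lam γ l : ℝ) (N i j : ℕ) : quadCoeffScaled β lam γ l N i j =
    quadCoeff β γ l N i j * radial lam (-(γ / 2)) (sq2 (node l N i, node l N j)) := by
  rw [quadCoeffScaled, div_eq_mul_inv, inv_exp_mul_eucl_rpow]

lemma cell_quadrature {l : ℝ} (hl : 0 < l) {N : ℕ} (hN : 0 < N) {i j : ℕ}
    (h : ¬(i = 0 ∧ j = 0)) (β γ : ℝ) (φ : ℝ × ℝ → ℝ) :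
    W1 β γ l N i j * φ (node l N i, node l N j) +
      W2 β γ l N (i + 1) j * φ (node l N (i + 1), node l N j) +
      W3 β γ l N i (j + 1) * φ (node l N i, node l N (j + 1)) +
      W4 β γ l N (i + 1) (j + 1) * φ (node l N (i + 1), node l N (j + 1)) =
    ∫ z in cell l N i j,
      bilin φ (node l N i) (node l N j) (mesh l N) z / mesh l N ^ 2 * weight β γ z := by
  have hi : ∀ a b : ℝ, IntegrableOn (fun z : ℝ × ℝ => (z.1 - a) * (z.2 - b) * weight β γ z)
      (cell l N i j) := fun a b => integrableOn_mul_weight hl hN h β γ (by fun_prop)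
  simp only [W1, W2, W3, W4, add_tsub_cancel_right, moment_eq hl hN h]
  simp only [node_succ]
  set a := node l N i
  set b := node l N j
  set d := mesh l N
  have e : (fun z : ℝ × ℝ => bilin φ a b d z / d ^ 2 * weight β γ z) = fun z =>
      φ (a, b) / d ^ 2 * ((z.1 - (a + d)) * (z.2 - (b + d)) * weight β γ z) +
      -(φ (a + d, b) / d ^ 2) * ((z.1 - a) * (z.2 - (b + d)) * weight β γ z) +
      -(φ (a, b + d) / d ^ 2) * ((z.1 - (a + d)) * (z.2 - b) * weight β γ z) +
      φ (a + d, b + d) / d ^ 2 * ((z.1 - a) * (z.2 - b) * weight β γ z) := by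
    funext z
    simp only [bilin]
    ring
  rw [e, integral_linear_comb (hi _ _) (hi _ _) (hi _ _) (hi _ _)]
  ring

/-! ### The truncation error -/

/-- The symmetrized difference times the tempered kernel. -/
def symKernel (β lam : ℝ) (u : ℝ × ℝ → ℝ) (x z : ℝ × ℝ) : ℝ :=
  symDiff4 u x z * temperedKernel β lam z

lemma sq2_neg_fst (z : ℝ × ℝ) : sq2 (-z.1, z.2) = sq2 z := by simp [sq2]

lemma sq2_neg_snd (z : ℝ × ℝ) : sq2 (z.1, -z.2) = sq2 z := by simp [sq2]

lemma sq2_neg_both (z : ℝ × ℝ) : sq2 (-z.1, -z.2) = sq2 z := by simp [sq2]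

/-- After y = x - z, the kernel and the Euclidean cut-off are invariant under sign changes of z₁ and
z₂, so folding acts on the differences of `u` alone and produces `symDiff4`. -/
lemma integrable_and_setIntegral_pv {β lam : ℝ} {u : ℝ × ℝ → ℝ} {x : ℝ × ℝ} {ε : ℝ}
    (hint : IntegrableOn
      (fun y => (u x - u y) / (exp (lam * eucl (x - y)) * eucl (x - y) ^ (2 + β)))
      {y | ε < eucl (x - y)}) :
    IntegrableOn (symKernel β lam u x) (quadrant ∩ {z | ε < eucl z}) ∧
    ∫ y in {y | ε < eucl (x - y)},
        (u x - u y) / (exp (lam * eucl (x - y)) * eucl (x - y) ^ (2 + β)) =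
      ∫ z in quadrant ∩ {z | ε < eucl z}, symKernel β lam u x z := by
  have hceu : Continuous eucl := continuous_sq2.sqrt
  have hmS : MeasurableSet {y | ε < eucl (x - y)} :=
    measurableSet_lt measurable_const (hceu.measurable.comp (measurable_const.sub measurable_id))
  have hmT : MeasurableSet {z | ε < eucl z} := measurableSet_lt measurable_const hceu.measurable
  set F := fun y => (u x - u y) / (exp (lam * eucl (x - y)) * eucl (x - y) ^ (2 + β)) with hF
  set H := fun z => {y | ε < eucl (x - y)}.indicator F (x - z) with hH
  have hHi : Integrable H := ((integrable_indicator_iff hmS).2 hint).comp_sub_left x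
  have hfold : foldSum H = {z | ε < eucl z}.indicator (symKernel β lam u x) := by
    funext z
    have hHz : ∀ z', eucl z' = eucl z → H z' =
        if ε < eucl z then (u x - u (x - z')) * temperedKernel β lam z else 0 := by
      intro z' hz'
      simp only [hH, indicator, mem_ofPred_eq, sub_sub_cancel, hF, hz', temperedKernel,
        mul_one_div]
    have e1 : eucl (-z.1, z.2) = eucl z := by rw [eucl_eq, sq2_neg_fst, eucl_eq]
    have e2 : eucl (z.1, -z.2) = eucl z := by rw [eucl_eq, sq2_neg_snd, eucl_eq]
    have e3 : eucl (-z.1, -z.2) = eucl z := by rw [eucl_eq, sq2_neg_both, eucl_eq]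
    rw [foldSum, hHz z rfl, hHz _ e1, hHz _ e2, hHz _ e3]
    simp only [indicator, mem_ofPred_eq]
    split_ifs with h
    · obtain ⟨x1, x2⟩ := x
      obtain ⟨z1, z2⟩ := z
      simp only [symKernel, symDiff4, Prod.mk_sub_mk, sub_neg_eq_add]
      ring
    · ring
  constructor
  · have h := integrable_foldSum hHi
    rw [hfold, integrable_indicator_iff hmT] at h
    exact h.mono_set inter_subset_right
  · rw [← integral_indicator hmS, ← integral_sub_left_eq_self _ volume x, ← setIntegral_indicator hmT,
      ← hfold]
    exact integral_eq_quadrant hHi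

section

variable {β lam γ l A : ℝ} {u : ℝ × ℝ → ℝ} {x : ℝ × ℝ}

/-- The quadratic vanishing of `symDiff4` lowers the singularity from order 2 + β to β, integrable
in the plane once β < 2. -/
lemma abs_symKernel_le (hlam : 0 ≤ lam) (hβ : 0 < β) (h₁ : LineBound A u)
    (h₂ : LineBound A (u ∘ Prod.swap)) {z : ℝ × ℝ} (hz : 0 < ‖z‖) :
    |symKernel β lam u x z| ≤ 2 * A * ‖z‖ ^ (-β) := by
  have hs := sq2_pos hz
  have hA := h₁.nonneg
  rw [symKernel, abs_mul, abs_of_nonneg (temperedKernel_nonneg β lam z)]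
  calc _ ≤ 2 * A * sq2 z * sq2 z ^ (-((2 + β) / 2)) := by
        gcongr
        · exact temperedKernel_nonneg β lam z
        · exact abs_symDiff4_le h₁ h₂ x z
        · exact temperedKernel_le hlam z
    _ = 2 * A * sq2 z ^ (-β / 2) := by
        rw [mul_assoc, mul_comm (sq2 z), ← rpow_add_one hs.ne']
        congr 2
        ring
    _ ≤ _ := by
        gcongr
        exact sq2_rpow_le hz (by linarith)

lemma abs_setIntegral_near_le (hlam : 0 ≤ lam) (hβ : 0 < β) (hβ2 : β < 2) (h₁ : LineBound A u)
    (h₂ : LineBound A (u ∘ Prod.swap)) {R : ℝ} (hR : 0 < R) {S : Set (ℝ × ℝ)}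
    (hS : MeasurableSet S) (hSR : S ⊆ quadrant ∩ {z | ‖z‖ ≤ R}) :
    |∫ z in S, symKernel β lam u x z| ≤ 2 * A * (polarConst / (2 - β) * R ^ (2 - β)) := by
  have hA := h₁.nonneg
  have hi : IntegrableOn (fun z : ℝ × ℝ => 2 * A * ‖z‖ ^ (-β)) {z | ‖z‖ ≤ R} :=
    (integrableOn_norm_rpow_near (by linarith) hR).const_mul _
  have hSR' : S ⊆ {z | ‖z‖ ≤ R} := fun z hz => (hSR hz).2
  have h1 : |∫ z in S, symKernel β lam u x z| ≤ ∫ z in S, 2 * A * ‖z‖ ^ (-β) := by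
    rw [← Real.norm_eq_abs]
    refine norm_integral_le_of_norm_le (hi.mono_set hSR') ?_
    refine (ae_restrict_iff' hS).2 (ae_of_all _ fun z hz => abs_symKernel_le hlam hβ h₁ h₂ ?_)
    exact lt_norm_of_fst (hSR hz).1.1
  refine h1.trans ((setIntegral_mono_set hi (ae_of_all _ fun z => ?_) hSR'.eventuallyLE).trans ?_)
  · exact mul_nonneg (by positivity) (rpow_nonneg (norm_nonneg z) _)
  · rw [integral_const_mul, setIntegral_norm_rpow_near (by linarith) hR,
      show -β + 2 = 2 - β by ring]

lemma Gzero_le (hγβ : β < γ) (hγ : γ ≤ 2) (hβ : 0 < β) (hl : 0 < l) {N : ℕ} (hN : 0 < N) :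
    Gzero β γ l N ≤ polarConst / (γ - β) * mesh l N ^ (γ - β) := by
  have hh := mesh_pos hl hN
  have hi := integrableOn_norm_rpow_near (a := γ - 2 - β) (by linarith) hh
  have hsub : cell l N 0 0 ⊆ {z : ℝ × ℝ | ‖z‖ ≤ mesh l N} := by
    intro z hz
    rw [cell_eq, node_zero, zero_add] at hz
    rw [mem_ofPred_eq, Prod.norm_def, Real.norm_eq_abs, Real.norm_eq_abs, abs_of_nonneg hz.1.1,
      abs_of_nonneg hz.2.1]
    exact max_le hz.1.2 hz.2.2
  have hne : ∀ᵐ z : ℝ × ℝ, z ≠ 0 := by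
    rw [ae_iff]
    simp
  have h1 : Gzero β γ l N ≤ ∫ z in cell l N 0 0, ‖z‖ ^ (γ - 2 - β) := by
    refine integral_mono_of_nonneg (ae_of_all _ (weight_nonneg β γ)) (hi.mono_set hsub)
      (ae_restrict_of_ae (hne.mono fun z hz => ?_))
    exact sq2_rpow_le (norm_pos_iff.2 hz) (by linarith)
  refine h1.trans ((setIntegral_mono_set hi (ae_of_all _ fun z => ?_) hsub.eventuallyLE).trans ?_)
  · exact rpow_nonneg (norm_nonneg z) _
  · rw [setIntegral_norm_rpow_near (by linarith) hh, show γ - 2 - β + 2 = γ - β by ring]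

lemma abs_phi_le (hlam : 0 ≤ lam) (hγ0 : 0 ≤ γ) (hγ : γ ≤ 2) (h₁ : LineBound A u)
    (h₂ : LineBound A (u ∘ Prod.swap)) {z : ℝ × ℝ} {h : ℝ} (hh : 0 < h) (hz0 : 0 < sq2 z)
    (hz : sq2 z ≤ 2 * h ^ 2) :
    |phi lam (-(γ / 2)) u x z| ≤ 4 * A * h ^ (2 - γ) := by
  have hA := h₁.nonneg
  rw [phi, abs_mul, abs_of_nonneg (radial_nonneg _ _ hz0.le)]
  calc _ ≤ 2 * A * sq2 z * sq2 z ^ (-(γ / 2)) := by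
        gcongr
        · exact radial_nonneg _ _ hz0.le
        · exact abs_symDiff4_le h₁ h₂ x z
        · exact radial_le hlam hz0.le
    _ = 2 * A * sq2 z ^ ((2 - γ) / 2) := by
        rw [mul_assoc, mul_comm (sq2 z), ← rpow_add_one hz0.ne']
        congr 2
        ring
    _ ≤ 2 * A * (2 * h ^ 2) ^ ((2 - γ) / 2) := by
        gcongr
    _ = 2 * A * (2 ^ ((2 - γ) / 2) * h ^ (2 - γ)) := by
        rw [mul_rpow (by norm_num) (by positivity), ← rpow_natCast h, ← rpow_mul hh.le]
        congr 4
        push_cast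
        ring
    _ ≤ 2 * A * (2 ^ (1 : ℝ) * h ^ (2 - γ)) := by
        gcongr
        · norm_num
        · linarith
    _ = _ := by rw [rpow_one]; ring

/-- The value has size h^(γ-β) · h^(2-γ), the order of the integral it replaces, so it is bounded by
itself. Of k_γ only 0 ≤ k_γ ≤ 4/3 matters. -/
lemma abs_origin_quadrature_le (hlam : 0 ≤ lam) (hβ : 0 < β) (hγβ : β < γ) (hγ : γ ≤ 2)
    (hl : 0 < l) {N : ℕ} (hN : 0 < N) (h₁ : LineBound A u) (h₂ : LineBound A (u ∘ Prod.swap)) :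
    |kGamma γ / 4 * Gzero β γ l N * (phi lam (-(γ / 2)) u x (node l N 0, node l N 1) +
      phi lam (-(γ / 2)) u x (node l N 1, node l N 1) +
      phi lam (-(γ / 2)) u x (node l N 1, node l N 0))| ≤
      4 * (polarConst / (γ - β)) * A * mesh l N ^ (2 - β) := by
  have hh := mesh_pos hl hN
  have hA := h₁.nonneg
  have hG := Gzero_le hγβ hγ hβ hl hN
  have hG0 := Gzero_nonneg β γ l N
  have hk := kGamma_le γ
  have hk0 := kGamma_nonneg γ
  rw [node_zero, node_one]
  set h := mesh l N
  have hp2 : 0 < h ^ 2 := by positivity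
  have b1 := abs_phi_le (x := x) (z := (0, h)) hlam (by linarith) hγ h₁ h₂ hh
    (by simp only [sq2]; nlinarith) (by simp only [sq2]; nlinarith)
  have b2 := abs_phi_le (x := x) (z := (h, h)) hlam (by linarith) hγ h₁ h₂ hh
    (by simp only [sq2]; nlinarith) (by simp only [sq2]; nlinarith)
  have b3 := abs_phi_le (x := x) (z := (h, 0)) hlam (by linarith) hγ h₁ h₂ hh
    (by simp only [sq2]; nlinarith) (by simp only [sq2]; nlinarith)
  rw [abs_mul, abs_of_nonneg (mul_nonneg (by positivity) hG0)]
  have hP : 0 ≤ h ^ (2 - γ) := rpow_nonneg hh.le _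
  have hP' : 0 ≤ polarConst / (γ - β) * h ^ (γ - β) := hG0.trans hG
  calc _ ≤ (4 / 3) / 4 * (polarConst / (γ - β) * h ^ (γ - β)) *
        (4 * A * h ^ (2 - γ) + 4 * A * h ^ (2 - γ) + 4 * A * h ^ (2 - γ)) := by
        refine mul_le_mul (by gcongr) ((abs_add_three _ _ _).trans (by gcongr)) (abs_nonneg _)
          (by positivity)
    _ = 4 * (polarConst / (γ - β)) * A * (h ^ (γ - β) * h ^ (2 - γ)) := by ring
    _ = _ := by rw [← rpow_add hh]; congr 2; ring

/-- Here r^(-2-β) = r^(-γ) · r^(γ-2-β): the first factor belongs to `phi`, the second to `weight`,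
and γ drops out of the product. -/
lemma abs_cell_error_le (hlam : 0 ≤ lam) (hγ0 : 0 ≤ γ) (hγ : γ ≤ 2) (hl : 0 < l) {N : ℕ}
    (hN : 0 < N) {i j : ℕ} (h : ¬(i = 0 ∧ j = 0)) (h₁ : LineBound A u)
    (h₂ : LineBound A (u ∘ Prod.swap))
    (hint : IntegrableOn (symKernel β lam u x) (cell l N i j)) :
    |(∫ z in cell l N i j, symKernel β lam u x z) -
      ∫ z in cell l N i j, bilin (phi lam (-(γ / 2)) u x) (node l N i) (node l N j) (mesh l N) z /
        mesh l N ^ 2 * weight β γ z| ≤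
      ∫ z in cell l N i j, 504 * A * mesh l N ^ 2 * sq2 z ^ (-((2 + β) / 2)) := by
  have hi : IntegrableOn (fun z => bilin (phi lam (-(γ / 2)) u x) (node l N i) (node l N j)
      (mesh l N) z / mesh l N ^ 2 * weight β γ z) (cell l N i j) :=
    integrableOn_mul_weight hl hN h β γ (by unfold bilin; fun_prop)
  rw [← integral_sub hint hi, ← Real.norm_eq_abs]
  refine norm_integral_le_of_norm_le
    ((integrableOn_cell hl hN h (continuousOn_sq2_rpow _)).const_mul _) ?_
  refine (ae_restrict_iff' (measurableSet_cell l N i j)).2 (ae_of_all _ fun z hz => ?_)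
  have hs := sq2_pos_of_mem_cell hl hN h hz
  have hw : 0 ≤ weight β γ z := weight_nonneg β γ z
  have e1 : sq2 z ^ (-(γ / 2)) * weight β γ z = sq2 z ^ (-((2 + β) / 2)) := by
    rw [weight_eq, ← rpow_add hs]
    congr 1
    ring
  have e : symKernel β lam u x z = phi lam (-(γ / 2)) u x z * weight β γ z := by
    rw [symKernel, phi, temperedKernel_eq, radial, radial, ← e1]
    ring
  rw [e, ← sub_mul, Real.norm_eq_abs, abs_mul, abs_of_nonneg hw]
  rw [cell_eq] at hz
  calc _ ≤ 504 * A * mesh l N ^ 2 * sq2 z ^ (-(γ / 2)) * weight β γ z := by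
        gcongr
        exact abs_phi_sub_bilin_le hlam (by linarith) (by linarith) h₁ h₂ x (node_nonneg hl N i)
          (node_nonneg hl N j) (mesh_pos hl hN) (mesh_sq_le_sq2_node hl N h) hz
    _ = _ := by rw [mul_assoc, e1]

/-- The square has side 2l, so moving one coordinate by more than 2l leaves it. -/
lemma symDiff4_of_far (hx : x ∈ square l) (hu : ∀ y ∉ square l, u y = 0) {z : ℝ × ℝ}
    (hz : z ∈ quadrant ∩ {z | 2 * l < ‖z‖}) : symDiff4 u x z = 4 * u x := by
  obtain ⟨hq, hz⟩ := hz
  rw [mem_ofPred_eq, norm_of_mem_quadrant hq, lt_max_iff] at hz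
  obtain ⟨⟨a1, a2⟩, a3, a4⟩ := hx
  have h : ∀ y : ℝ × ℝ, (y.1 = x.1 + z.1 ∨ y.1 = x.1 - z.1) → (y.2 = x.2 + z.2 ∨ y.2 = x.2 - z.2) →
      u y = 0 := by
    rintro y h1 h2
    refine hu y ?_
    rintro ⟨⟨b1, b2⟩, b3, b4⟩
    rcases hz with hz | hz
    · rcases h1 with h1 | h1 <;> linarith
    · rcases h2 with h2 | h2 <;> linarith
  rw [symDiff4, h (x.1 + z.1, x.2 + z.2) (.inl rfl) (.inl rfl),
    h (x.1 - z.1, x.2 + z.2) (.inr rfl) (.inl rfl), h (x.1 + z.1, x.2 - z.2) (.inl rfl) (.inr rfl),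
    h (x.1 - z.1, x.2 - z.2) (.inr rfl) (.inr rfl)]
  ring

lemma setIntegral_far (hβ : 0 < β) (hlam : 0 ≤ lam) (hl : 0 < l) (hx : x ∈ square l)
    (hu : ∀ y ∉ square l, u y = 0) :
    ∫ z in quadrant ∩ {z | 2 * l < ‖z‖}, symKernel β lam u x z = 4 * Ginf β lam l * u x := by
  rw [Ginf_eq hβ hlam hl, mul_right_comm, ← integral_const_mul]
  refine setIntegral_congr_fun (measurableSet_quadrant.inter (measurableSet_norm_gt _))
    fun z hz => ?_
  simp only [symKernel, symDiff4_of_far hx hu hz]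

/-- The constant of the truncation error. -/
def truncConst (β γ : ℝ) : ℝ :=
  2 * (polarConst / (2 - β)) + 504 * (polarConst / β) + 4 * (polarConst / (γ - β))

lemma truncConst_nonneg (hβ : 0 < β) (hβ2 : β < 2) (hγβ : β < γ) : 0 ≤ truncConst β γ := by
  have h0 := polarConst_nonneg
  have h1 : 0 < 2 - β := by linarith
  have h2 : 0 < γ - β := by linarith
  unfold truncConst
  positivity

/-- The discretization of the integral of `symKernel` over the quadrant. -/
def discreteSum (β lam γ l : ℝ) (N : ℕ) (u : ℝ × ℝ → ℝ) (x : ℝ × ℝ) : ℝ :=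
  4 * Ginf β lam l * u x + ∑ p ∈ (Finset.range (N + 1) ×ˢ Finset.range (N + 1)).erase (0, 0),
    quadCoeffScaled β lam γ l N p.1 p.2 * symDiff4 u x (node l N p.1, node l N p.2)

/-- The cell bounds add up to h² times the integral of r^(-2-β) over ‖z‖ > h, which is O(h^(-β)). -/
lemma abs_setIntegral_frame_sub_le (hlam : 0 ≤ lam) (hβ : 0 < β) (hγβ : β < γ) (hγ : γ ≤ 2)
    (hl : 0 < l) {N : ℕ} (hN : 0 < N) (h₁ : LineBound A u) (h₂ : LineBound A (u ∘ Prod.swap))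
    (hint : ∀ R, 0 < R → IntegrableOn (symKernel β lam u x) (quadrant ∩ {z | R < ‖z‖}))
    (hcell : ∀ i j, ¬(i = 0 ∧ j = 0) → IntegrableOn (symKernel β lam u x) (cell l N i j)) :
    |(∫ z in frame l N, symKernel β lam u x z) -
      ∑ p ∈ (Finset.range N ×ˢ Finset.range N).erase (0, 0), ∫ z in cell l N p.1 p.2,
        bilin (phi lam (-(γ / 2)) u x) (node l N p.1) (node l N p.2) (mesh l N) z /
        mesh l N ^ 2 * weight β γ z| ≤ 504 * (polarConst / β) * A * mesh l N ^ (2 - β) := by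
  have hh := mesh_pos hl hN
  have hA := h₁.nonneg
  have hfi : IntegrableOn (symKernel β lam u x) (frame l N) :=
    (hint _ hh).mono_set fun z hz => ⟨hz.1, hz.2.1⟩
  have hfar : IntegrableOn (fun z => 504 * A * mesh l N ^ 2 * sq2 z ^ (-((2 + β) / 2)))
      {z : ℝ × ℝ | mesh l N < ‖z‖} := (integrableOn_sq2_rpow_far hβ hh).const_mul _
  rw [setIntegral_frame hl hN hfi, ← Finset.sum_sub_distrib]
  refine (Finset.abs_sum_le_sum_abs _ _).trans ((Finset.sum_le_sum fun p hp => ?_).trans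
    ((setIntegral_frame hl hN (hfar.mono_set (frame_subset l N))).symm.le.trans ?_))
  · have hp0 : ¬(p.1 = 0 ∧ p.2 = 0) := fun h => (Finset.mem_erase.1 hp).1 (Prod.ext h.1 h.2)
    exact abs_cell_error_le hlam (by linarith) hγ hl hN hp0 h₁ h₂ (hcell _ _ hp0)
  · refine (setIntegral_mono_set hfar (ae_of_all _ fun z =>
      mul_nonneg (by positivity) (rpow_nonneg (sq2_nonneg z) _))
      (frame_subset l N).eventuallyLE).trans ?_
    rw [integral_const_mul]
    calc _ ≤ 504 * A * mesh l N ^ 2 * (polarConst / β * mesh l N ^ (-β)) := by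
          gcongr
          exact setIntegral_sq2_rpow_far_le hβ hh
      _ = 504 * (polarConst / β) * A * (mesh l N ^ 2 * mesh l N ^ (-β)) := by ring
      _ = _ := by
          rw [← rpow_natCast, ← rpow_add hh]
          congr 2

lemma discreteSum_eq (hl : 0 < l) {N : ℕ} (hN : 2 ≤ N) :
    discreteSum β lam γ l N u x = 4 * Ginf β lam l * u x +
      (kGamma γ / 4 * Gzero β γ l N * (phi lam (-(γ / 2)) u x (node l N 0, node l N 1) +
        phi lam (-(γ / 2)) u x (node l N 1, node l N 1) +
        phi lam (-(γ / 2)) u x (node l N 1, node l N 0)) +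
      ∑ p ∈ (Finset.range N ×ˢ Finset.range N).erase (0, 0), ∫ z in cell l N p.1 p.2,
        bilin (phi lam (-(γ / 2)) u x) (node l N p.1) (node l N p.2) (mesh l N) z /
        mesh l N ^ 2 * weight β γ z) := by
  rw [discreteSum]
  congr 1
  have e : ∀ p : ℕ × ℕ, quadCoeffScaled β lam γ l N p.1 p.2 *
      symDiff4 u x (node l N p.1, node l N p.2) = quadCoeff β γ l N p.1 p.2 *
      (fun i j => phi lam (-(γ / 2)) u x (node l N i, node l N j)) p.1 p.2 := by
    intro p
    rw [quadCoeffScaled_eq]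
    simp only [phi]
    ring
  refine (Finset.sum_congr rfl fun p _ => e p).trans ((sum_quadCoeff hN
    fun i j => phi lam (-(γ / 2)) u x (node l N i, node l N j)).trans ?_)
  congr 1
  refine Finset.sum_congr rfl fun p hp => ?_
  have hp0 : ¬(p.1 = 0 ∧ p.2 = 0) := fun h => (Finset.mem_erase.1 hp).1 (Prod.ext h.1 h.2)
  exact cell_quadrature hl (by omega) hp0 β γ (phi lam (-(γ / 2)) u x)

lemma le_eucl {z : ℝ × ℝ} : ‖z‖ ≤ eucl z :=
  le_sqrt_of_sq_le (norm_sq_le_sq2 z)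

/-- The three parts of `truncConst` are the integral near the origin, the interpolation error on the
frame and the trapezoidal value; the far part is exact. The bound does not depend on ε. -/
lemma abs_setIntegral_sub_discreteSum_le (hlam : 0 ≤ lam) (hβ : 0 < β) (hβ2 : β < 2)
    (hγβ : β < γ) (hγ : γ ≤ 2) (hl : 0 < l) {N : ℕ} (hN : 2 ≤ N) (hcont : Continuous u)
    (h₁ : LineBound A u) (h₂ : LineBound A (u ∘ Prod.swap)) (hx : x ∈ square l)
    (hu : ∀ y ∉ square l, u y = 0)
    (hint : ∀ ε > 0, IntegrableOn (symKernel β lam u x) (quadrant ∩ {z | ε < eucl z}))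
    {ε : ℝ} (hε : 0 < ε) (hεh : ε < mesh l N) :
    |(∫ z in quadrant ∩ {z | ε < eucl z}, symKernel β lam u x z) - discreteSum β lam γ l N u x| ≤
      truncConst β γ * A * mesh l N ^ (2 - β) := by
  have hN0 : 0 < N := by omega
  have hh := mesh_pos hl hN0
  have hhL : mesh l N ≤ 2 * l := by
    rw [← node_last l hN0]
    exact mesh_le_node hl N (by omega)
  have hint' : ∀ R, 0 < R → IntegrableOn (symKernel β lam u x) (quadrant ∩ {z | R < ‖z‖}) :=
    fun R hR => (hint R hR).mono_set fun z hz => ⟨hz.1, lt_of_lt_of_le hz.2 le_eucl⟩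
  have hcell : ∀ i j, ¬(i = 0 ∧ j = 0) → IntegrableOn (symKernel β lam u x) (cell l N i j) := by
    intro i j h
    refine integrableOn_cell hl hN0 h (ContinuousOn.mul ?_ (continuousOn_temperedKernel β lam))
    unfold symDiff4
    fun_prop
  have hmeucl : MeasurableSet {z | ε < eucl z} :=
    measurableSet_lt measurable_const continuous_sq2.sqrt.measurable
  -- The deleted set is a Euclidean disc. As ‖z‖ ≤ `eucl z` and ε < h, it only affects the cell at
  -- the origin.
  set S := quadrant ∩ {z | ε < eucl z} ∩ {z : ℝ × ℝ | ‖z‖ ≤ mesh l N} with hS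
  have hmS : MeasurableSet S := (measurableSet_quadrant.inter hmeucl).inter
    (measurableSet_le measurable_norm measurable_const)
  have hsplit : quadrant ∩ {z | ε < eucl z} =
      S ∪ (frame l N ∪ quadrant ∩ {z | 2 * l < ‖z‖}) := by
    ext z
    have hz : ‖z‖ ≤ eucl z := le_eucl
    simp only [hS, frame, mem_inter_iff, mem_union, mem_ofPred_eq]
    constructor
    · rintro ⟨h1, h2⟩
      rcases le_or_gt ‖z‖ (mesh l N) with h3 | h3
      · exact Or.inl ⟨⟨h1, h2⟩, h3⟩
      · rcases le_or_gt ‖z‖ (2 * l) with h4 | h4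
        · exact Or.inr (Or.inl ⟨h1, h3, h4⟩)
        · exact Or.inr (Or.inr ⟨h1, h4⟩)
    · rintro (h | h | h)
      · exact h.1
      · exact ⟨h.1, by linarith [h.2.1]⟩
      · exact ⟨h.1, by linarith [h.2]⟩
  have hmfar : MeasurableSet (quadrant ∩ {z : ℝ × ℝ | 2 * l < ‖z‖}) :=
    measurableSet_quadrant.inter (measurableSet_norm_gt _)
  have hfi : IntegrableOn (symKernel β lam u x) (frame l N) :=
    (hint' _ hh).mono_set fun z hz => ⟨hz.1, hz.2.1⟩
  have hfar := hint' (2 * l) (by positivity)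
  have hd1 : Disjoint (frame l N) (quadrant ∩ {z | 2 * l < ‖z‖}) :=
    Set.disjoint_left.2 fun z h h' => absurd h.2.2 (not_le.2 h'.2)
  have hd2 : Disjoint S (frame l N ∪ quadrant ∩ {z | 2 * l < ‖z‖}) := by
    refine Set.disjoint_left.2 fun z h h' => ?_
    have h3 : ‖z‖ ≤ mesh l N := h.2
    rcases h' with h' | h'
    · exact absurd h3 (not_le.2 h'.2.1)
    · exact absurd h3 (not_le.2 (hhL.trans_lt h'.2))
  rw [hsplit, setIntegral_union hd2 ((measurableSet_frame l N).union hmfar)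
    ((hint ε hε).mono_set inter_subset_left) (hfi.union hfar),
    setIntegral_union hd1 hmfar hfi hfar, setIntegral_far hβ hlam hl hx hu, discreteSum_eq hl hN]
  have b1 := abs_setIntegral_near_le (x := x) hlam hβ hβ2 h₁ h₂ hh hmS fun z hz => ⟨hz.1.1, hz.2⟩
  have b2 := abs_setIntegral_frame_sub_le hlam hβ hγβ hγ hl hN0 h₁ h₂ hint' hcell
  have b3 := abs_origin_quadrature_le (x := x) hlam hβ hγβ hγ hl hN0 h₁ h₂
  rw [truncConst]
  rw [abs_le] at *
  constructor <;> linarith [b1.1, b1.2, b2.1, b2.2, b3.1, b3.2]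

/-- The bound is uniform in ε < h, so it passes to the principal value limit. -/
lemma truncation (hβ0 : 0 < β) (hβ2 : β < 2) (hlam : 0 ≤ lam) (hβlam : lam ≠ 0 → β ≠ 1)
    (hγβ : β < γ) (hγ : γ ≤ 2) (hl : 0 < l) {N : ℕ} (hN : 2 ≤ N) (hcont : Continuous u)
    (h₁ : LineBound A u) (h₂ : LineBound A (u ∘ Prod.swap)) (hx : x ∈ square l)
    (hu : ∀ y ∉ square l, u y = 0) {v : ℝ} (hv : IsNegTemperedLaplacianAt β lam u x v) :
    |v - normConst 2 β lam * discreteSum β lam γ l N u x| ≤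
      normConst 2 β lam * (truncConst β γ * A * mesh l N ^ (2 - β)) := by
  have hh := mesh_pos hl (by omega : 0 < N)
  have hc := normConst_pos hβ0 hβ2 hβlam
  obtain ⟨hint, hlim⟩ := hv
  have hlim' := (hlim.sub_const (normConst 2 β lam * discreteSum β lam γ l N u x)).abs
  refine le_of_tendsto hlim' ?_
  filter_upwards [Ioo_mem_nhdsGT hh] with ε hε
  rw [(integrable_and_setIntegral_pv (hint ε hε.1)).2, ← mul_sub, abs_mul, abs_of_pos hc]
  gcongr
  exact abs_setIntegral_sub_discreteSum_le hlam hβ0 hβ2 hγβ hγ hl hN hcont h₁ h₂ hx hu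
    (fun ε' hε' => (integrable_and_setIntegral_pv (hint ε' hε')).1) hε.1 hε.2

end

/-! ### The grid -/

/-- The grid point with index `s`. -/
def gridPoint (l : ℝ) (N : ℕ) (s : Idx N) : ℝ × ℝ :=
  (-l + ((s.1 : ℝ) + 1) * mesh l N, -l + ((s.2 : ℝ) + 1) * mesh l N)

lemma card_mul_mesh (l : ℝ) {N : ℕ} (hN : 0 < N) : (N : ℝ) * mesh l N = 2 * l := by
  unfold mesh; field_simp

lemma gridPoint_mem {l : ℝ} (hl : 0 < l) {N : ℕ} (s : Idx N) : gridPoint l N s ∈ square l := by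
  have key : ∀ a : Fin (N - 1), -l + ((a : ℝ) + 1) * mesh l N ∈ Ioo (-l) l := by
    intro a
    have ha : (a : ℕ) + 1 < N := by omega
    have hN : 0 < N := by omega
    have hh := mesh_pos hl hN
    have h1 : ((a : ℝ) + 1) < N := by exact_mod_cast ha
    have h2 := card_mul_mesh l hN
    have h3 : 0 < ((a : ℝ) + 1) * mesh l N := by positivity
    have h4 := mul_lt_mul_of_pos_right h1 hh
    constructor <;> linarith
  exact ⟨key s.1, key s.2⟩

/-- Grid points off the interior index range lie outside the open square, where `u` vanishes. -/
lemma extendZero_gridValues {l : ℝ} (hl : 0 < l) {N : ℕ} (hN : 0 < N) {u : ℝ × ℝ → ℝ}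
    (hu : ∀ y ∉ square l, u y = 0) (m n : ℤ) :
    extendZero (gridValues l N u) m n =
      u (-l + ((m : ℝ) + 1) * mesh l N, -l + ((n : ℝ) + 1) * mesh l N) := by
  have key : ∀ m : ℤ, -l + ((m : ℝ) + 1) * mesh l N ∈ Ioo (-l) l →
      0 ≤ m ∧ m < (N - 1 : ℕ) := by
    rintro m ⟨h1, h2⟩
    have hh := mesh_pos hl hN
    have h3 := card_mul_mesh l hN
    have h4 : (0 : ℝ) < (m : ℝ) + 1 := pos_of_mul_pos_left (by linarith) hh.le
    have h5 : (m : ℝ) + 1 < N := lt_of_mul_lt_mul_right (by linarith) hh.le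
    have h4' : 0 < m + 1 := by exact_mod_cast h4
    have h5' : m + 1 < N := by exact_mod_cast h5
    omega
  unfold extendZero
  split_ifs with h
  · have e1 : ((m.toNat : ℕ) : ℝ) = m := by exact_mod_cast Int.toNat_of_nonneg h.1.1
    have e2 : ((n.toNat : ℕ) : ℝ) = n := by exact_mod_cast Int.toNat_of_nonneg h.2.1
    simp only [gridValues, e1, e2]
  · exact (hu _ fun hm => h ⟨key m hm.1, key n hm.2⟩).symm

lemma mulVec_gridValues {β lam γ l : ℝ} (hl : 0 < l) {N : ℕ} (hN : 0 < N) {u : ℝ × ℝ → ℝ}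
    (hu : ∀ y ∉ square l, u y = 0) (s : Idx N) :
    (stiffness β lam γ l N).mulVec (gridValues l N u) s =
      normConst 2 β lam * discreteSum β lam γ l N u (gridPoint l N s) := by
  rw [stiffness_mulVec, discreteSum]
  congr 2
  refine Finset.sum_congr rfl fun p _ => ?_
  congr 1
  simp only [fourSum, extendZero_gridValues hl hN hu, symDiff4, gridPoint, gridValues, node]
  push_cast
  ring_nf

/-! ### Discrete norms -/

lemma discreteLinftyNorm_le {N : ℕ} {V : Idx N → ℝ} {K : ℝ} (hK : 0 ≤ K) (h : ∀ s, |V s| ≤ K) :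
    discreteLinftyNorm N V ≤ K :=
  -- Nonnegativity of K covers the empty grid, on which the real supremum is 0.
  Real.iSup_le h hK

/-- There are (N - 1)² points of mass h², and Nh = 2l. -/
lemma discreteL2Norm_le {l : ℝ} (hl : 0 < l) {N : ℕ} (hN : 0 < N) {V : Idx N → ℝ} {K : ℝ}
    (hK : 0 ≤ K) (h : ∀ s, |V s| ≤ K) : discreteL2Norm l N V ≤ 2 * l * K := by
  refine sqrt_le_iff.2 ⟨by positivity, ?_⟩
  have h1 : ∑ s, V s ^ 2 ≤ (N : ℝ) ^ 2 * K ^ 2 := by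
    calc ∑ s, V s ^ 2 ≤ ∑ _s : Idx N, K ^ 2 :=
          Finset.sum_le_sum fun s _ => sq_le_sq' (abs_le.1 (h s)).1 (abs_le.1 (h s)).2
      _ = ((N - 1 : ℕ) : ℝ) ^ 2 * K ^ 2 := by
          rw [Finset.sum_const, Finset.card_univ, Fintype.card_prod, Fintype.card_fin,
            nsmul_eq_mul, Nat.cast_mul]
          ring
      _ ≤ _ := by
          gcongr
          exact Nat.sub_le N 1
  calc _ ≤ mesh l N ^ 2 * ((N : ℝ) ^ 2 * K ^ 2) := by gcongr
    _ = ((N : ℝ) * mesh l N) ^ 2 * K ^ 2 := by ring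
    _ = _ := by rw [card_mul_mesh l hN]; ring

/-! ### The error at the grid points and the main estimate -/

lemma hasCompactSupport_of_eq_zero {l : ℝ} {u : ℝ × ℝ → ℝ} (hu : ∀ y ∉ square l, u y = 0) :
    HasCompactSupport u :=
  HasCompactSupport.intro (K := Icc (-l) l ×ˢ Icc (-l) l) (isCompact_Icc.prod isCompact_Icc)
    fun y hy => hu y fun h => hy ⟨Ioo_subset_Icc_self h.1, Ioo_subset_Icc_self h.2⟩

/-- B(U - U_h) = BU - F is minus the truncation error, to which the stability bound applies; the
normalization constant cancels. -/
lemma abs_error_le {β lam γ l : ℝ} (hβ0 : 0 < β) (hβ2 : β < 2) (hlam : 0 ≤ lam)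
    (hβlam : lam ≠ 0 → β ≠ 1) (hγβ : β < γ) (hγ : γ ≤ 2) (hl : 0 < l) {u f : ℝ × ℝ → ℝ}
    (hu : ContDiff ℝ 2 u) (hsol : IsExactSolution β lam l f u) {N : ℕ} {Uh : Idx N → ℝ}
    (hUh : (stiffness β lam γ l N).mulVec Uh = gridValues l N f) (s : Idx N) :
    |(gridValues l N u - Uh) s| ≤
      truncConst β γ / (4 * Ginf β lam l) * secondDerivSup u * mesh l N ^ (2 - β) := by
  -- An interior index exists only if N ≥ 2.
  have hN : 2 ≤ N := by have := s.1.2; omega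
  have hsupp := hasCompactSupport_of_eq_zero hsol.2
  have hc := normConst_pos hβ0 hβ2 hβlam
  have hG := Ginf_pos hβ0 hlam hl
  refine (abs_le_of_mulVec hc hG (quadCoeffScaled_nonneg (γ := γ) hl hN) _ (R := normConst 2 β lam *
    (truncConst β γ * secondDerivSup u * mesh l N ^ (2 - β))) (fun t => ?_) s).trans_eq ?_
  · rw [Matrix.mulVec_sub, Pi.sub_apply, mulVec_gridValues hl (by omega) hsol.2, hUh, abs_sub_comm]
    exact truncation hβ0 hβ2 hlam hβlam hγβ hγ hl hN hu.continuous (lineBound_of_contDiff hu hsupp)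
      (lineBound_swap_of_contDiff hu hsupp) (gridPoint_mem hl t) hsol.2
      (hsol.1 _ (gridPoint_mem hl t))
  · field_simp

end

end TemperedFD

theorem mainTheorem1 (β lam γ l : ℝ) (hβ0 : 0 < β) (hβ2 : β < 2)
    (hlam : 0 ≤ lam) (hβlam : lam ≠ 0 → β ≠ 1)
    (hγβ : β < γ) (hγ2 : γ ≤ 2) (hl : 0 < l) :
    ∃ C : ℝ, 0 < C ∧ ∀ u f : ℝ × ℝ → ℝ, ContDiff ℝ 2 u →
      TemperedFD.IsExactSolution β lam l f u →
      ∀ N : ℕ, 0 < N →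
        (∃! Uh : TemperedFD.Idx N → ℝ,
          (TemperedFD.stiffness β lam γ l N).mulVec Uh = TemperedFD.gridValues l N f) ∧
        ∀ Uh : TemperedFD.Idx N → ℝ,
          (TemperedFD.stiffness β lam γ l N).mulVec Uh = TemperedFD.gridValues l N f →
          TemperedFD.discreteL2Norm l N (TemperedFD.gridValues l N u - Uh) ≤
              C * TemperedFD.secondDerivSup u * TemperedFD.mesh l N ^ (2 - β) ∧
          TemperedFD.discreteLinftyNorm N (TemperedFD.gridValues l N u - Uh) ≤
              C * TemperedFD.secondDerivSup u * TemperedFD.mesh l N ^ (2 - β) := by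
  have hc := TemperedFD.normConst_pos hβ0 hβ2 hβlam
  have hG := TemperedFD.Ginf_pos hβ0 hlam hl
  set K := TemperedFD.truncConst β γ / (4 * TemperedFD.Ginf β lam l)
  have hK : 0 ≤ K := div_nonneg (TemperedFD.truncConst_nonneg hβ0 hβ2 hγβ) (by positivity)
  -- K serves the maximum norm and 2lK the L² norm; the 1 makes the constant positive.
  refine ⟨(1 + 2 * l) * K + 1, by positivity, fun u f hu hsol N hN => ⟨?_, fun Uh hUh => ?_⟩⟩
  · rcases Nat.lt_or_ge 1 N with h | h
    · exact TemperedFD.existsUnique_mulVec hc hG (TemperedFD.quadCoeffScaled_nonneg hl h) _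
    -- For N = 1 there are no interior points and the system is empty.
    · have hN1 : N - 1 = 0 := by omega
      have : IsEmpty (TemperedFD.Idx N) := ⟨fun s => by have := s.1.2; omega⟩
      exact ⟨0, Subsingleton.elim _ _, fun _ _ => Subsingleton.elim _ _⟩
  · have hA : 0 ≤ TemperedFD.secondDerivSup u := Real.iSup_nonneg fun z => norm_nonneg _
    have hm : 0 ≤ TemperedFD.mesh l N ^ (2 - β) := rpow_nonneg (TemperedFD.mesh_pos hl hN).le _
    have herr := TemperedFD.abs_error_le hβ0 hβ2 hlam hβlam hγβ hγ2 hl hu hsol hUh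
    have hKA : 0 ≤ K * TemperedFD.secondDerivSup u * TemperedFD.mesh l N ^ (2 - β) := by positivity
    have hAm : 0 ≤ TemperedFD.secondDerivSup u * TemperedFD.mesh l N ^ (2 - β) := by positivity
    have h2 := TemperedFD.discreteL2Norm_le hl hN hKA herr
    have hinf := TemperedFD.discreteLinftyNorm_le hKA herr
    have hlK := mul_nonneg hl.le hKA
    constructor <;> nlinarith
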